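/- **Conventions.** For complex matrices $R_1,R_2$ of equal size put $\Delta(R_1,R_2)=\begin{bmatrix}R_1&R_2\\ \overline{R_2}&\overline{R_1}\end{bmatrix}$, and $J_k=\mathrm{diag}(I_k,-I_k)$. Transfer matrices are matrices of complex rational functions of $s$; $T^{\sim}(s)=(T(-\overline s))^*$; $\mathcal{RH}_\infty$ is the set of proper transfer matrices without poles in $\mathrm{Re}\,s\ge 0$. A transfer matrix is *doubled-up* if it has the form $\begin{bmatrix}R_1(s)&R_2(s)\\ \overline{R_2(\overline s)}&\overline{R_1(\overline s)}\end{bmatrix}$ (that is, if it maps doubled-up vectors of annihilation and creation operators to such vectors). It is *spectrally generic* if it has a minimal realization $(A,B,C,D)$ with $\lambda+\overline\nu\ne0$ for all eigenvalues $\lambda,\nu$ of $A$. An *open quantum harmonic oscillator* with $n$ modes and $m$ fields is a system with $$A=-i\Theta H-\tfrac12\Theta L^*J_mL,\quad B=-\Theta L^*J_m\Delta(S,0),\quad C=L,\quad D=\Delta(S,0),$$ where $\Theta=FJ_nF^*$, $F=\Delta(F_1,F_2)$, $H=H^*=\Delta(H_1,H_2)$ is of order $2n$, $L=\Delta(L_1,L_2)\in\mathbb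 C^{2m\times 2n}$, and $S\in\mathbb C^{m\times m}$ is unitary. A transfer matrix is *physically realizable* if it equals $C(sI-A)^{-1}B+D$ for such a system. Let $\mathbb D_\mu=\{\Delta(S,0): S\in\mathbb C^{\mu\times\mu}\text{ unitary}\}$. **Plant.** Let $P$ be the transfer matrix of an open quantum harmonic oscillator whose input fields are split as $(r,u)$ and output fields as $(z,y)$, where $r,z$ have the same number of components, and $u,y$ have $\mu$ components each. Let $\mathcal P$ be $P$ with the inputs regrouped from $(r,u,r^\#,u^\#)$ to $(r,r^\#,u,u^\#)$ and the outputs regrouped from $(z,y,z^\#,y^\#)$ to $(z,z^\#,y,y^\#)$. Let $\mathcal P_{22}$ be its block from $(u,u^\#)$ to $(y,y^\#)$, with the induced realization $(A,\boldsymbol B_2,\boldsymbol C_2,\boldsymbol D_{22})$. The controller $K$ closes the loop by $u=Ky$ (in doubled-up form). **Theorem.** Suppose that $\mathcal P_{22}=NM^{-1}=\widehat M^{-1}\widehat N$ with $N,M,\widehat N,\widehat M\in\mathcal{RH}_\infty$, and that $U,V,\widehat U,\widehat V\in\mathcal{RH}_\infty$ satisfy $$\begin{bmatrix}\widehat V&-\widehat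 U\\-\widehat N&\widehat M\end{bmatrix}\begin{bmatrix}M&U\\N&V\end{bmatrix}=\begin{bmatrix}I&0\\0&I\end{bmatrix}.$$ Let $\mathcal Q$ be the set of all $Q\in\mathcal{RH}_\infty$ with $\det\big((V+NQ)(\infty)\big)\neq0$ and $\Phi+Q^{\sim}\Lambda+\Lambda^{\sim}Q+Q^{\sim}\Pi Q=0$, where $$\Phi=U^{\sim}J_\mu U-V^{\sim}J_\mu V,\quad \Lambda=M^{\sim}J_\mu U-N^{\sim}J_\mu V,\quad \Pi=M^{\sim}J_\mu M-N^{\sim}J_\mu N.$$ Let $\widehat{\mathcal Q}$ be the set of those $Q\in\mathcal Q$ for which $K=(U+MQ)(V+NQ)^{-1}$ is doubled-up, spectrally generic and satisfies $K(\infty)\in\mathbb D_\mu$. Then for every $Q\in\widehat{\mathcal Q}$: 1. $V+NQ$ and $\widehat V+Q\widehat N$ are invertible, and $K=(U+MQ)(V+NQ)^{-1}=(\widehat V+Q\widehat N)^{-1}(\widehat U+Q\widehat M)$. If $V$ is invertible, then so are $\widehat V$ and $I+V^{-1}NQ$, and $K$ is the lower linear fractional transformation $UV^{-1}+\widehat V^{-1}Q(I+V^{-1}NQ)^{-1}V^{-1}$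 of $\begin{bmatrix}UV^{-1}&\widehat V^{-1}\\V^{-1}&-V^{-1}N\end{bmatrix}$ and $Q$. 2. $K$ is stabilizing: $\begin{bmatrix}I&-K\\-\mathcal P_{22}&I\end{bmatrix}^{-1}$ exists and belongs to $\mathcal{RH}_\infty$, and the feedback loop formed by any stabilizable and detectable realizations of $\mathcal P_{22}$ and $K$ is well-posed and has a Hurwitz state matrix. In particular, if $(A,\boldsymbol B_2,\boldsymbol C_2)$ is stabilizable and detectable, then the loop of the plant with any stabilizable and detectable realization of $K$ is internally stable. 3. $K$ is physically realizable. -/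

import Mathlib

open Matrix

noncomputable section

/-! Complex rational functions and transfer matrices -/

/-- Coefficientwise complex conjugation of a polynomial. -/
def polyConj : Polynomial ℂ →+* Polynomial ℂ := Polynomial.mapRingHom (starRingEnd ℂ)

theorem polyConj_injective : Function.Injective polyConj :=
  Polynomial.map_injective _ (starRingEnd ℂ).injective

/-- The substitution `s ↦ -s` in a polynomial. -/
def polyNeg : Polynomial ℂ →+* Polynomial ℂ := Polynomial.compRingHom (-Polynomial.X)

theorem polyNeg_injective : Function.Injective polyNeg := by
  intro p q h
  have h' := congrArg (fun t : Polynomial ℂ => t.comp (-Polynomial.X)) h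
  simpa [polyNeg, Polynomial.comp_assoc] using h'

/-- The rational function `s ↦ conj (f (conj s))`. -/
def ratConj : RatFunc ℂ →+* RatFunc ℂ :=
  RatFunc.mapRingHom polyConj
    (nonZeroDivisors_le_comap_nonZeroDivisors_of_injective _ polyConj_injective)

/-- The rational function `s ↦ f (-s)`. -/
def ratNeg : RatFunc ℂ →+* RatFunc ℂ :=
  RatFunc.mapRingHom polyNeg
    (nonZeroDivisors_le_comap_nonZeroDivisors_of_injective _ polyNeg_injective)

/-- A rational function is proper if it is finite at infinity. -/
def IsProper (f : RatFunc ℂ) : Prop := f.num.natDegree ≤ f.denom.natDegree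

/-- The value at infinity of a proper rational function (the denominator is monic). -/
def valInfty (f : RatFunc ℂ) : ℂ := f.num.coeff f.denom.natDegree

/-- Membership in `RH_∞`: proper, with all poles in the open left half-plane. -/
def IsStableRat (f : RatFunc ℂ) : Prop :=
  IsProper f ∧ ∀ s : ℂ, 0 ≤ s.re → f.denom.eval s ≠ 0

/-- Rational transfer matrices with outputs indexed by `o` and inputs indexed by `ι`. -/
abbrev TransferMatrix (o ι : Type) := Matrix o ι (RatFunc ℂ)

/-- The class `RH_∞` of transfer matrices. -/
def IsRHInf {o ι : Type} (T : TransferMatrix o ι) : Prop := ∀ i j, IsStableRat (T i j)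

/-- A constant matrix as a transfer matrix. -/
def constTM {o ι : Type} (D : Matrix o ι ℂ) : TransferMatrix o ι := D.map RatFunc.C

/-- The system conjugate `T~(s) = (T (-conj s))^*`. -/
def sysConj {o ι : Type} (T : TransferMatrix o ι) : TransferMatrix ι o :=
  (T.map fun f => ratConj (ratNeg f))ᵀ

/-- `T` is proper and `T(∞) = D`. -/
def HasFeedthrough {o ι : Type} (T : TransferMatrix o ι) (D : Matrix o ι ℂ) : Prop :=
  (∀ i j, IsProper (T i j)) ∧ T.map valInfty = D

/-- The matrix `Δ(R₁, R₂)`. -/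
def doubled {o ι : Type} (R₁ R₂ : Matrix o ι ℂ) : Matrix (o ⊕ o) (ι ⊕ ι) ℂ :=
  fromBlocks R₁ R₂ (R₂.map star) (R₁.map star)

/-- Transfer matrices between doubled-up signals: those of the form
`[R₁(s), R₂(s); conj R₂(conj s), conj R₁(conj s)]`. -/
def IsDoubledUp {o ι : Type} (T : TransferMatrix (o ⊕ o) (ι ⊕ ι)) : Prop :=
  ∃ R₁ R₂ : TransferMatrix o ι, T = fromBlocks R₁ R₂ (R₂.map ratConj) (R₁.map ratConj)

/-- The signature matrix `J = diag(I, -I)`. -/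
def sigJ (ι : Type) [DecidableEq ι] (R : Type) [Ring R] : Matrix (ι ⊕ ι) (ι ⊕ ι) R :=
  fromBlocks 1 0 0 (-1)

/-- The set `𝔻` of the matrices `Δ(S, 0)` with unitary `S`. -/
def unitaryDoubled (ι : Type) [Fintype ι] [DecidableEq ι] : Set (Matrix (ι ⊕ ι) (ι ⊕ ι) ℂ) :=
  {D | ∃ S ∈ unitaryGroup ι ℂ, D = doubled S 0}

/-! State-space realizations -/

/-- A quadruple `(A, B, C, D)` with states `σ`, inputs `ι` and outputs `o`. -/
structure StateSpace (σ ι o : Type) where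
  A : Matrix σ σ ℂ
  B : Matrix σ ι ℂ
  C : Matrix o σ ℂ
  D : Matrix o ι ℂ

/-- All eigenvalues lie in the open left half-plane. -/
def IsHurwitz {σ : Type} [Fintype σ] [DecidableEq σ] (A : Matrix σ σ ℂ) : Prop :=
  ∀ z ∈ spectrum ℂ A, z.re < 0

/-- `z + conj w ≠ 0` for all eigenvalues `z`, `w`. -/
def IsSpectrallyGeneric {σ : Type} [Fintype σ] [DecidableEq σ] (A : Matrix σ σ ℂ) : Prop :=
  ∀ z ∈ spectrum ℂ A, ∀ w ∈ spectrum ℂ A, z + star w ≠ 0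

namespace StateSpace

variable {σ ι o : Type} [Fintype σ] [DecidableEq σ] [Fintype ι]

/-- The transfer matrix `C (s I - A)⁻¹ B + D`. -/
def transfer (X : StateSpace σ ι o) : TransferMatrix o ι :=
  constTM X.C * ((RatFunc.X : RatFunc ℂ) • (1 : TransferMatrix σ σ) - constTM X.A)⁻¹ * constTM X.B
    + constTM X.D

def Stabilizable (X : StateSpace σ ι o) : Prop :=
  ∃ F : Matrix ι σ ℂ, IsHurwitz (X.A + X.B * F)

def Detectable [Fintype o] (X : StateSpace σ ι o) : Prop :=
  ∃ L : Matrix σ o ℂ, IsHurwitz (X.A + L * X.C)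

/-- The columns of the matrices `A^k B` span the state space. -/
def Controllable (X : StateSpace σ ι o) : Prop :=
  (⨆ k : ℕ, LinearMap.range (X.A ^ k * X.B).mulVecLin) = ⊤

/-- The kernels of the matrices `C A^k` intersect trivially. -/
def Observable (X : StateSpace σ ι o) : Prop :=
  (⨅ k : ℕ, LinearMap.ker (X.C * X.A ^ k).mulVecLin) = ⊥

/-- A realization is minimal if it is controllable and observable. -/
def Minimal (X : StateSpace σ ι o) : Prop := X.Controllable ∧ X.Observable

end StateSpace

/-- A transfer matrix is spectrally generic if it has a spectrally generic minimal realization. -/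
def IsSpectrallyGenericTM {ι o : Type} [Fintype ι] (T : TransferMatrix o ι) : Prop :=
  ∃ (k : ℕ) (X : StateSpace (Fin k) ι o),
    X.transfer = T ∧ X.Minimal ∧ IsSpectrallyGeneric X.A

/-! Open quantum harmonic oscillators -/

/-- Parameters of an open quantum harmonic oscillator with modes `ν` coupled to bosonic fields `ι`:
the dynamic variables `F₁ 𝔞 + F₂ 𝔞^#`, the Hamiltonian matrix `Δ(H₁, H₂)`, the coupling matrix
`Δ(L₁, L₂)` and the scattering matrix `S`. -/
structure OpenOscillator (ν ι : Type) [Fintype ν] [DecidableEq ν] [Fintype ι] [DecidableEq ι] where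
  F₁ : Matrix ν ν ℂ
  F₂ : Matrix ν ν ℂ
  H₁ : Matrix ν ν ℂ
  H₂ : Matrix ν ν ℂ
  hermitian : (doubled H₁ H₂).IsHermitian
  L₁ : Matrix ι ν ℂ
  L₂ : Matrix ι ν ℂ
  S : Matrix ι ι ℂ
  unitary : S ∈ unitaryGroup ι ℂ

namespace OpenOscillator

variable {ν ι : Type} [Fintype ν] [DecidableEq ν] [Fintype ι] [DecidableEq ι]

/-- The generalized commutation matrix `Θ = F J F^*`. -/
def ccr (G : OpenOscillator ν ι) : Matrix (ν ⊕ ν) (ν ⊕ ν) ℂ :=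
  doubled G.F₁ G.F₂ * sigJ ν ℂ * (doubled G.F₁ G.F₂)ᴴ

/-- The quadruple `(A, B, C, D)` of the quantum stochastic differential equations. -/
def toStateSpace (G : OpenOscillator ν ι) : StateSpace (ν ⊕ ν) (ι ⊕ ι) (ι ⊕ ι) where
  A := -(Complex.I • (G.ccr * doubled G.H₁ G.H₂))
    - (1 / 2 : ℂ) • (G.ccr * (doubled G.L₁ G.L₂)ᴴ * sigJ ι ℂ * doubled G.L₁ G.L₂)
  B := -(G.ccr * (doubled G.L₁ G.L₂)ᴴ * sigJ ι ℂ * doubled G.S 0)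
  C := doubled G.L₁ G.L₂
  D := doubled G.S 0

/-- The transfer matrix of the oscillator. -/
def transfer (G : OpenOscillator ν ι) : TransferMatrix (ι ⊕ ι) (ι ⊕ ι) :=
  G.toStateSpace.transfer

/-- Plant whose fields are split into exogenous ones (`ρ`) and those joined to the controller (`κ`):
the transfer matrix with the signals `(r, u, r^#, u^#)` and `(z, y, z^#, y^#)` regrouped as
`(r, r^#, u, u^#)` and `(z, z^#, y, y^#)`. -/
def modifiedPlant {ρ κ : Type} [Fintype ρ] [DecidableEq ρ] [Fintype κ] [DecidableEq κ]
    (G : OpenOscillator ν (ρ ⊕ κ)) :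
    TransferMatrix ((ρ ⊕ ρ) ⊕ (κ ⊕ κ)) ((ρ ⊕ ρ) ⊕ (κ ⊕ κ)) :=
  reindex (Equiv.sumSumSumComm ρ κ ρ κ) (Equiv.sumSumSumComm ρ κ ρ κ) G.transfer

/-- The realization `(A, B₂, C₂, D₂₂)` of the `(2,2)` block of the modified plant. -/
def stateSpace22 {ρ κ : Type} [Fintype ρ] [DecidableEq ρ] [Fintype κ] [DecidableEq κ]
    (G : OpenOscillator ν (ρ ⊕ κ)) : StateSpace (ν ⊕ ν) (κ ⊕ κ) (κ ⊕ κ) where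
  A := G.toStateSpace.A
  B := G.toStateSpace.B.submatrix id (Sum.map Sum.inr Sum.inr)
  C := G.toStateSpace.C.submatrix (Sum.map Sum.inr Sum.inr) id
  D := G.toStateSpace.D.submatrix (Sum.map Sum.inr Sum.inr) (Sum.map Sum.inr Sum.inr)

end OpenOscillator

/-- Physical realizability: `T` is the transfer matrix of an open quantum harmonic oscillator. -/
def IsPhysicallyRealizable {ι : Type} [Fintype ι] [DecidableEq ι]
    (T : TransferMatrix (ι ⊕ ι) (ι ⊕ ι)) : Prop :=
  ∃ (n : ℕ) (G : OpenOscillator (Fin n) ι), G.transfer = T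

/-! Internal stability of the feedback loop `u = K y`, `y = P u` -/

section Feedback

variable {σ τ κ : Type} [Fintype σ] [DecidableEq σ] [Fintype τ] [DecidableEq τ]
  [Fintype κ] [DecidableEq κ]

/-- The state matrix of the feedback loop of the systems `X` and `Y` with states `(x, y)`. -/
def closedLoopA (X : StateSpace σ κ κ) (Y : StateSpace τ κ κ) : Matrix (σ ⊕ τ) (σ ⊕ τ) ℂ :=
  fromBlocks X.A 0 0 Y.A
    + fromBlocks X.B 0 0 Y.B * (fromBlocks 1 (-Y.D) (-X.D) 1)⁻¹ * fromBlocks 0 Y.C X.C 0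

/-- The loop of `X` and `Y` is well-posed, and its state matrix is Hurwitz (so that without
exogenous inputs the states of both systems converge to zero). -/
def InternallyStable (X : StateSpace σ κ κ) (Y : StateSpace τ κ κ) : Prop :=
  IsUnit (1 - X.D * Y.D).det ∧ IsHurwitz (closedLoopA X Y)

/-- `K` internally stabilizes the system `X`: the loop of `X` with every stabilizable and
detectable realization of `K` is internally stable. -/
def StabilizesSystem (X : StateSpace σ κ κ) (K : TransferMatrix κ κ) : Prop :=
  ∀ (k : ℕ) (Y : StateSpace (Fin k) κ κ), Y.transfer = K → Y.Stabilizable → Y.Detectable →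
    InternallyStable X Y

/-- `K` internally stabilizes the transfer matrix `P`: all the transfer matrices from signals
injected into the loop to the signals in the loop exist and belong to `RH_∞`, and `K` stabilizes
every stabilizable and detectable realization of `P`. -/
def StabilizesTransfer (P K : TransferMatrix κ κ) : Prop :=
  (1 - P * K).det ≠ 0 ∧
  IsRHInf (fromBlocks 1 (-K) (-P) 1 : TransferMatrix (κ ⊕ κ) (κ ⊕ κ))⁻¹ ∧
  ∀ (k : ℕ) (X : StateSpace (Fin k) κ κ), X.transfer = P → X.Stabilizable → X.Detectable →
    StabilizesSystem X K

/-- The lower linear fractional transformation of the block matrix with blocks `O₁₁, …, O₂₂`. -/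
def lowerLFT (O₁₁ O₁₂ O₂₁ O₂₂ Q : TransferMatrix κ κ) : TransferMatrix κ κ :=
  O₁₁ + O₁₂ * Q * (1 - O₂₂ * Q)⁻¹ * O₂₁

/-! Factorizations and the Youla-Kucera parameter -/

/-- Coprime factorizations `P = N M⁻¹ = M'⁻¹ N'` over `RH_∞`, with auxiliary factors
`U, V, U', V'` in `RH_∞` that satisfy the general Bezout identity. -/
structure IsDoublyCoprime (P N M N' M' U V U' V' : TransferMatrix κ κ) : Prop where
  N_stable : IsRHInf N
  M_stable : IsRHInf M
  N'_stable : IsRHInf N'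
  M'_stable : IsRHInf M'
  U_stable : IsRHInf U
  V_stable : IsRHInf V
  U'_stable : IsRHInf U'
  V'_stable : IsRHInf V'
  M_det : M.det ≠ 0
  M'_det : M'.det ≠ 0
  right_fact : P = N * M⁻¹
  left_fact : P = M'⁻¹ * N'
  bezout : fromBlocks V' (-U') (-N') M' * fromBlocks M U N V = 1

/-- The controller `(U + M Q) (V + N Q)⁻¹`. -/
def youla (N M U V Q : TransferMatrix κ κ) : TransferMatrix κ κ :=
  (U + M * Q) * (V + N * Q)⁻¹

/-- The class `𝒬`: `Q` in `RH_∞` with `det (V + N Q)(∞) ≠ 0` and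
`Φ + Q~ Λ + Λ~ Q + Q~ Π Q = 0`. -/
def classQ (N M U V : TransferMatrix (κ ⊕ κ) (κ ⊕ κ)) : Set (TransferMatrix (κ ⊕ κ) (κ ⊕ κ)) :=
  let J := sigJ κ (RatFunc ℂ)
  let Φ := sysConj U * J * U - sysConj V * J * V
  let Λ := sysConj M * J * U - sysConj N * J * V
  let Pi := sysConj M * J * M - sysConj N * J * N
  {Q | IsRHInf Q ∧ ((V + N * Q).map valInfty).det ≠ 0 ∧
    Φ + sysConj Q * Λ + sysConj Λ * Q + sysConj Q * Pi * Q = 0}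

/-- The class `𝒬̂`: those `Q` in `𝒬` for which the controller is a spectrally generic doubled-up
transfer matrix with `K(∞)` in `𝔻`. -/
def classQhat (N M U V : TransferMatrix (κ ⊕ κ) (κ ⊕ κ)) :
    Set (TransferMatrix (κ ⊕ κ) (κ ⊕ κ)) :=
  {Q | Q ∈ classQ N M U V ∧ IsDoubledUp (youla N M U V Q) ∧
    IsSpectrallyGenericTM (youla N M U V Q) ∧
    ∃ D ∈ unitaryDoubled κ, HasFeedthrough (youla N M U V Q) D}

end Feedback

end

/-! Stability. Multiplying the two Bezout factors by the triangular matrices with off-diagonal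
blocks `-Q` and `Q` gives another Bezout identity, with `U + M Q`, `V + N Q` in place of `U`, `V`
(`IsDoublyCoprime.shift`). It therefore suffices to treat `K = U V⁻¹`. Then the loop matrix with
rows `(1, -K)` and `(-P, 1)` equals `diag(V'⁻¹, M'⁻¹)` times the left Bezout factor, so its inverse
is the right Bezout factor times `diag(V', M')`, which is stable. To reach state matrices,
stabilizable and detectable realizations of `P` and `K` are joined. Output feedback preserves both
properties, and the closed-loop transfer matrix is a polynomial expression in constants and the
stable inverse. A stabilizable and detectable realization of a stable transfer matrix is Hurwitz.

Physical realizability. The quadratic constraint on `Q` says exactly that `K~ J K = J`. Being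
doubled-up means invariance under conjugation combined with the exchange of the two halves of a
signal. By uniqueness of minimal realizations this symmetry acts on the state space as an antilinear
involution, and in suitable coordinates it is plain conjugation (`exists_realMinimal`): `A` is real
and the rows of `C` come in conjugate pairs.

Spectral genericity makes `A^* P + P A = -C^* J C` uniquely solvable. Uniqueness passes symmetries
on to `P`: it is Hermitian, and `conj P = -P`. Losslessness gives `B^* P = -D^* J C`
(`lyapunov_lossless`), and observability makes `P` invertible. With `Θ = P⁻¹` these are the
oscillator relations for `A` and `B`, for a real symmetric Hamiltonian matrix. Finally the `k` real
variables are embedded diagonally into the doubled vector of `k` modes. The resulting oscillator is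
not minimal, but no canonical form of `Θ` is needed. -/

noncomputable section

/-! ### Proper and stable rational functions -/

section RationalFunctions

-- `num` and `denom` refer to the reduced fraction, whereas sums, products and inverses come as
-- unreduced ones. Comparing degrees and top coefficients in the cross-multiplied identity transfers
-- the information.
open Polynomial in
theorem IsProper.div {p q : ℂ[X]} (hq : q ≠ 0) (h : p.natDegree ≤ q.natDegree) :
    IsProper (algebraMap ℂ[X] (RatFunc ℂ) p / algebraMap ℂ[X] (RatFunc ℂ) q) ∧
      valInfty (algebraMap ℂ[X] (RatFunc ℂ) p / algebraMap ℂ[X] (RatFunc ℂ) q) =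
        p.coeff q.natDegree / q.leadingCoeff := by
  set f : RatFunc ℂ := algebraMap ℂ[X] (RatFunc ℂ) p / algebraMap ℂ[X] (RatFunc ℂ) q with hf
  have key : f.num * q = p * f.denom := (RatFunc.num_mul_eq_mul_denom_iff hq).2 hf
  have hd : f.denom ≠ 0 := f.denom_ne_zero
  have hprop : f.num.natDegree ≤ f.denom.natDegree := by
    by_cases hn : f.num = 0
    · simp [hn]
    have h1 := natDegree_mul hn hq
    have h2 : (p * f.denom).natDegree ≤ p.natDegree + f.denom.natDegree := natDegree_mul_le
    rw [key] at h1
    omega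
  refine ⟨hprop, ?_⟩
  have h1 := coeff_mul_add_eq_of_natDegree_le hprop (le_refl q.natDegree)
  have h2 := coeff_mul_add_eq_of_natDegree_le h (le_refl f.denom.natDegree)
  have h3 : f.denom.coeff f.denom.natDegree = 1 := f.monic_denom
  rw [eq_div_iff (leadingCoeff_ne_zero.2 hq), valInfty, leadingCoeff, ← h1, key, add_comm, h2, h3,
    mul_one]

theorem IsProper.add_valInfty {f g : RatFunc ℂ} (hf : IsProper f) (hg : IsProper g) :
    IsProper (f + g) ∧ valInfty (f + g) = valInfty f + valInfty g := by
  have hfd := f.denom_ne_zero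
  have hgd := g.denom_ne_zero
  have e : f + g = algebraMap _ (RatFunc ℂ) (f.num * g.denom + f.denom * g.num) /
      algebraMap _ (RatFunc ℂ) (f.denom * g.denom) := by
    conv_lhs => rw [← RatFunc.num_div_denom f, ← RatFunc.num_div_denom g]
    rw [div_add_div _ _ (RatFunc.algebraMap_ne_zero hfd) (RatFunc.algebraMap_ne_zero hgd)]
    simp
  have hdeg := Polynomial.natDegree_mul hfd hgd
  unfold IsProper at hf hg
  have h1 : (f.num * g.denom).natDegree ≤ f.denom.natDegree + g.denom.natDegree :=
    Polynomial.natDegree_mul_le.trans (by omega)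
  have h2 : (f.denom * g.num).natDegree ≤ f.denom.natDegree + g.denom.natDegree :=
    Polynomial.natDegree_mul_le.trans (by omega)
  have h := IsProper.div (p := f.num * g.denom + f.denom * g.num) (mul_ne_zero hfd hgd)
    (by rw [hdeg]; exact Polynomial.natDegree_add_le_of_degree_le h1 h2)
  rw [← e] at h
  refine ⟨h.1, h.2.trans ?_⟩
  rw [(f.monic_denom.mul g.monic_denom).leadingCoeff, div_one, hdeg, Polynomial.coeff_add,
    Polynomial.coeff_mul_add_eq_of_natDegree_le hf le_rfl,
    Polynomial.coeff_mul_add_eq_of_natDegree_le le_rfl hg]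
  have e1 : f.denom.coeff f.denom.natDegree = 1 := f.monic_denom
  have e2 : g.denom.coeff g.denom.natDegree = 1 := g.monic_denom
  rw [e1, e2, mul_one, one_mul]
  rfl

theorem IsProper.mul_valInfty {f g : RatFunc ℂ} (hf : IsProper f) (hg : IsProper g) :
    IsProper (f * g) ∧ valInfty (f * g) = valInfty f * valInfty g := by
  have hfd := f.denom_ne_zero
  have hgd := g.denom_ne_zero
  have e : f * g = algebraMap _ (RatFunc ℂ) (f.num * g.num) /
      algebraMap _ (RatFunc ℂ) (f.denom * g.denom) := by
    conv_lhs => rw [← RatFunc.num_div_denom f, ← RatFunc.num_div_denom g]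
    rw [div_mul_div_comm]
    simp
  have hdeg := Polynomial.natDegree_mul hfd hgd
  unfold IsProper at hf hg
  have h := IsProper.div (p := f.num * g.num) (mul_ne_zero hfd hgd)
    (by rw [hdeg]; exact Polynomial.natDegree_mul_le.trans (by omega))
  rw [← e] at h
  refine ⟨h.1, h.2.trans ?_⟩
  rw [(f.monic_denom.mul g.monic_denom).leadingCoeff, div_one, hdeg,
    Polynomial.coeff_mul_add_eq_of_natDegree_le hf hg]
  rfl

theorem isProper_C (c : ℂ) : IsProper (RatFunc.C c) := by simp [IsProper]

@[simp] theorem valInfty_C (c : ℂ) : valInfty (RatFunc.C c) = c := by simp [valInfty]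

theorem isProper_zero : IsProper 0 := by simp [IsProper]

theorem isProper_one : IsProper 1 := by simp [IsProper]

@[simp] theorem valInfty_zero : valInfty 0 = 0 := by simp [valInfty]

@[simp] theorem valInfty_one : valInfty 1 = 1 := by simp [valInfty]

theorem IsProper.inv_X : IsProper (RatFunc.X : RatFunc ℂ)⁻¹ ∧
    valInfty (RatFunc.X : RatFunc ℂ)⁻¹ = 0 := by
  have := IsProper.div (p := 1) (q := Polynomial.X) Polynomial.X_ne_zero (by simp)
  simpa [Polynomial.coeff_one] using this

/-- The subring of proper rational functions. -/
def properSubring : Subring (RatFunc ℂ) where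
  carrier := {f | IsProper f}
  mul_mem' hf hg := (hf.mul_valInfty hg).1
  one_mem' := isProper_one
  add_mem' hf hg := (hf.add_valInfty hg).1
  zero_mem' := isProper_zero
  neg_mem' hf := by simpa using ((isProper_C (-1)).mul_valInfty hf).1

/-- The value at infinity as a ring homomorphism. -/
def valInftyHom : properSubring →+* ℂ where
  toFun f := valInfty f
  map_one' := valInfty_one
  map_zero' := valInfty_zero
  map_mul' f g := (f.2.mul_valInfty g.2).2
  map_add' f g := (f.2.add_valInfty g.2).2

theorem isProper_inv {f : RatFunc ℂ} (h : valInfty f ≠ 0) : IsProper f⁻¹ := by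
  have hdn : f.denom.natDegree ≤ f.num.natDegree := Polynomial.le_natDegree_of_ne_zero h
  have hn : f.num ≠ 0 := by
    intro h0
    simp [valInfty, h0] at h
  have := (IsProper.div (p := f.denom) hn hdn).1
  rwa [← inv_div, RatFunc.num_div_denom] at this

/-- The subring of rational functions without pole at `s`. -/
def regularAt (s : ℂ) : Subring (RatFunc ℂ) where
  carrier := {f | f.denom.eval s ≠ 0}
  mul_mem' {f g} hf hg h0 := by
    have := Polynomial.eval_dvd (x := s) (RatFunc.denom_mul_dvd f g)
    rw [h0, zero_dvd_iff, Polynomial.eval_mul] at this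
    exact mul_ne_zero hf hg this
  one_mem' := by simp
  add_mem' {f g} hf hg h0 := by
    have := Polynomial.eval_dvd (x := s) (RatFunc.denom_add_dvd f g)
    rw [h0, zero_dvd_iff, Polynomial.eval_mul] at this
    exact mul_ne_zero hf hg this
  zero_mem' := by simp
  neg_mem' {f} hf h0 := by
    have := Polynomial.eval_dvd (x := s) (RatFunc.denom_mul_dvd (RatFunc.C (-1)) f)
    rw [show RatFunc.C (-1) * f = -f by simp, h0, zero_dvd_iff, Polynomial.eval_mul] at this
    exact mul_ne_zero (by rw [RatFunc.denom_C]; simp) hf this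

theorem algebraMap_mem_regularAt (s : ℂ) (p : Polynomial ℂ) :
    algebraMap _ (RatFunc ℂ) p ∈ regularAt s := by
  change Polynomial.eval s _ ≠ 0
  simp

theorem inv_algebraMap_mem_regularAt_iff {s : ℂ} {p : Polynomial ℂ} (hp : p ≠ 0) :
    (algebraMap _ (RatFunc ℂ) p)⁻¹ ∈ regularAt s ↔ p.eval s ≠ 0 := by
  set f := (algebraMap _ (RatFunc ℂ) p)⁻¹ with hf
  have key : f.num * p = 1 * f.denom := (RatFunc.num_mul_eq_mul_denom_iff hp).2 (by simp [hf])
  rw [one_mul] at key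
  change f.denom.eval s ≠ 0 ↔ _
  constructor
  · intro h h0
    rw [← key] at h
    simp [h0] at h
  · intro h h0
    have hd : f.denom ∣ p := by
      have := RatFunc.denom_div_dvd (1 : Polynomial ℂ) p
      simpa [hf] using this
    have := Polynomial.eval_dvd (x := s) hd
    rw [h0, zero_dvd_iff] at this
    exact h this

/-- The ring `RH_∞` of rational functions. -/
def stableSubring : Subring (RatFunc ℂ) where
  carrier := {f | IsStableRat f}
  mul_mem' {_ _} hf hg := ⟨(hf.1.mul_valInfty hg.1).1,
    fun s hs => (regularAt s).mul_mem (hf.2 s hs) (hg.2 s hs)⟩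
  one_mem' := ⟨isProper_one, fun s _ => (regularAt s).one_mem⟩
  add_mem' {_ _} hf hg := ⟨(hf.1.add_valInfty hg.1).1,
    fun s hs => (regularAt s).add_mem (hf.2 s hs) (hg.2 s hs)⟩
  zero_mem' := ⟨isProper_zero, fun s _ => (regularAt s).zero_mem⟩
  neg_mem' {_} hf := ⟨properSubring.neg_mem hf.1, fun s hs => (regularAt s).neg_mem (hf.2 s hs)⟩

theorem stableSubring_le_properSubring : stableSubring ≤ properSubring := fun _ hf => hf.1

theorem C_mem_regularAt (s c : ℂ) : RatFunc.C c ∈ regularAt s := by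
  change Polynomial.eval s _ ≠ 0
  simp

theorem C_mem_stableSubring (c : ℂ) : RatFunc.C c ∈ stableSubring :=
  ⟨isProper_C c, fun s _ => C_mem_regularAt s c⟩

end RationalFunctions

/-! ### Matrices with entries in a subring -/

section EntriesIn

variable {R : Type} [CommRing R] {o ι κ : Type}

/-- All the entries of a matrix belong to a subring. -/
def EntriesIn (S : Subring R) (M : Matrix o ι R) : Prop := ∀ i j, M i j ∈ S

variable {S : Subring R}

theorem EntriesIn.add {M N : Matrix o ι R} (hM : EntriesIn S M) (hN : EntriesIn S N) :
    EntriesIn S (M + N) := fun i j => S.add_mem (hM i j) (hN i j)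

theorem EntriesIn.sub {M N : Matrix o ι R} (hM : EntriesIn S M) (hN : EntriesIn S N) :
    EntriesIn S (M - N) := fun i j => S.sub_mem (hM i j) (hN i j)

theorem EntriesIn.neg {M : Matrix o ι R} (hM : EntriesIn S M) :
    EntriesIn S (-M) := fun i j => S.neg_mem (hM i j)

theorem EntriesIn.mul [Fintype ι] {M : Matrix o ι R} {N : Matrix ι κ R} (hM : EntriesIn S M)
    (hN : EntriesIn S N) : EntriesIn S (M * N) := fun i j =>
  S.sum_mem fun k _ => S.mul_mem (hM i k) (hN k j)

theorem EntriesIn.smul {M : Matrix o ι R} {c : R} (hc : c ∈ S) (hM : EntriesIn S M) :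
    EntriesIn S (c • M) := fun i j => S.mul_mem hc (hM i j)

theorem EntriesIn.one [DecidableEq ι] : EntriesIn S (1 : Matrix ι ι R) := fun i j => by
  rw [one_apply]
  split_ifs
  exacts [S.one_mem, S.zero_mem]

theorem EntriesIn.zero : EntriesIn S (0 : Matrix o ι R) := fun _ _ => S.zero_mem

theorem EntriesIn.mono {S' : Subring R} (h : S ≤ S') {M : Matrix o ι R} (hM : EntriesIn S M) :
    EntriesIn S' M := fun i j => h (hM i j)

theorem EntriesIn.fromBlocks {o' ι' : Type} {M₁ : Matrix o ι R} {M₂ : Matrix o ι' R}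
    {M₃ : Matrix o' ι R} {M₄ : Matrix o' ι' R} (h₁ : EntriesIn S M₁) (h₂ : EntriesIn S M₂)
    (h₃ : EntriesIn S M₃) (h₄ : EntriesIn S M₄) : EntriesIn S (fromBlocks M₁ M₂ M₃ M₄) := by
  rintro (i | i) (j | j)
  exacts [h₁ i j, h₂ i j, h₃ i j, h₄ i j]

/-- A matrix with entries in a subring as a matrix over that subring. -/
def EntriesIn.lift {M : Matrix o ι R} (hM : EntriesIn S M) : Matrix o ι S :=
  of fun i j => ⟨M i j, hM i j⟩

theorem EntriesIn.lift_map {M : Matrix o ι R} (hM : EntriesIn S M) :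
    hM.lift.map S.subtype = M := rfl

variable [Fintype ι] [DecidableEq ι]

theorem EntriesIn.det {M : Matrix ι ι R} (hM : EntriesIn S M) : M.det ∈ S := by
  rw [← hM.lift_map]
  change (S.subtype.mapMatrix _).det ∈ S
  rw [← RingHom.map_det]
  exact Subtype.prop _

theorem EntriesIn.adjugate {M : Matrix ι ι R} (hM : EntriesIn S M) : EntriesIn S M.adjugate := by
  rw [← hM.lift_map]
  change EntriesIn S (S.subtype.mapMatrix _).adjugate
  rw [← RingHom.map_adjugate]
  exact fun i j => Subtype.prop _

theorem EntriesIn.inv {F : Type} [Field F] {S : Subring F} {M : Matrix ι ι F} (hM : EntriesIn S M)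
    (hdet : M.det⁻¹ ∈ S) : EntriesIn S M⁻¹ := by
  rw [inv_def, Ring.inverse_eq_inv']
  exact hM.adjugate.smul hdet

end EntriesIn

/-! ### Proper transfer matrices -/

section ProperMatrices

variable {o ι κ : Type}

theorem map_valInfty_add {M N : TransferMatrix o ι} (hM : EntriesIn properSubring M)
    (hN : EntriesIn properSubring N) :
    (M + N).map valInfty = M.map valInfty + N.map valInfty := by
  ext i j
  exact (IsProper.add_valInfty (hM i j) (hN i j)).2

theorem map_valInfty_mul [Fintype ι] {M : TransferMatrix o ι} {N : TransferMatrix ι κ}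
    (hM : EntriesIn properSubring M) (hN : EntriesIn properSubring N) :
    (M * N).map valInfty = M.map valInfty * N.map valInfty := by
  have h : M * N = (hM.lift * hN.lift).map properSubring.subtype := by
    rw [Matrix.map_mul, hM.lift_map, hN.lift_map]
  rw [h]
  change (hM.lift * hN.lift).map valInftyHom = _
  rw [Matrix.map_mul]
  rfl

theorem valInfty_det [Fintype ι] [DecidableEq ι] {M : TransferMatrix ι ι}
    (hM : EntriesIn properSubring M) : valInfty M.det = (M.map valInfty).det := by
  have h : M.det = properSubring.subtype hM.lift.det := by
    rw [RingHom.map_det]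
    rfl
  rw [h]
  change valInftyHom hM.lift.det = _
  rw [RingHom.map_det]
  rfl

theorem map_valInfty_constTM (D : Matrix o ι ℂ) : (constTM D).map valInfty = D := by
  ext i j
  simp [constTM]

theorem entriesIn_proper_constTM (D : Matrix o ι ℂ) : EntriesIn properSubring (constTM D) :=
  fun _ _ => isProper_C _

theorem map_valInfty_one [DecidableEq ι] : (1 : TransferMatrix ι ι).map valInfty = 1 :=
  Matrix.map_one _ valInfty_zero valInfty_one

end ProperMatrices

/-! ### Constant transfer matrices -/

section ConstTM

variable {o ι κ : Type}

@[simp] theorem constTM_add (M N : Matrix o ι ℂ) : constTM (M + N) = constTM M + constTM N :=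
  Matrix.map_add _ (map_add _) M N

@[simp] theorem constTM_neg (M : Matrix o ι ℂ) : constTM (-M) = -constTM M := by
  ext i j
  simp [constTM]

@[simp] theorem constTM_mul [Fintype ι] (M : Matrix o ι ℂ) (N : Matrix ι κ ℂ) :
    constTM (M * N) = constTM M * constTM N := Matrix.map_mul

@[simp] theorem constTM_one [DecidableEq ι] : constTM (1 : Matrix ι ι ℂ) = 1 :=
  Matrix.map_one _ (map_zero _) (map_one _)

@[simp] theorem constTM_zero : constTM (0 : Matrix o ι ℂ) = 0 :=
  Matrix.map_zero _ (map_zero _)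

theorem constTM_fromBlocks {o' ι' : Type} (M₁ : Matrix o ι ℂ) (M₂ : Matrix o ι' ℂ)
    (M₃ : Matrix o' ι ℂ) (M₄ : Matrix o' ι' ℂ) : constTM (fromBlocks M₁ M₂ M₃ M₄) =
      fromBlocks (constTM M₁) (constTM M₂) (constTM M₃) (constTM M₄) := fromBlocks_map ..

end ConstTM

/-! ### Resolvents -/

section Resolvent

variable {σ ι o : Type} [Fintype σ] [DecidableEq σ]

/-- The matrix `s I - A`. -/
def charTM (A : Matrix σ σ ℂ) : TransferMatrix σ σ :=
  (RatFunc.X : RatFunc ℂ) • (1 : TransferMatrix σ σ) - constTM A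

/-- The rational matrix `(s I - A)⁻¹`. -/
def resolventTM (A : Matrix σ σ ℂ) : TransferMatrix σ σ := (charTM A)⁻¹

theorem charTM_eq_map (A : Matrix σ σ ℂ) :
    charTM A = (charmatrix A).map (algebraMap (Polynomial ℂ) (RatFunc ℂ)) := by
  ext i j
  by_cases h : i = j
  · subst h
    simp [charTM, constTM]
  · simp [charTM, constTM, h]

theorem det_charTM (A : Matrix σ σ ℂ) :
    (charTM A).det = algebraMap (Polynomial ℂ) (RatFunc ℂ) A.charpoly := by
  rw [charTM_eq_map, charpoly, RingHom.map_det]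
  rfl

theorem isUnit_det_charTM (A : Matrix σ σ ℂ) : IsUnit (charTM A).det := by
  rw [det_charTM, isUnit_iff_ne_zero]
  exact RatFunc.algebraMap_ne_zero A.charpoly_monic.ne_zero

theorem charTM_mul_resolventTM (A : Matrix σ σ ℂ) : charTM A * resolventTM A = 1 :=
  mul_nonsing_inv _ (isUnit_det_charTM A)

theorem resolventTM_mul_charTM (A : Matrix σ σ ℂ) : resolventTM A * charTM A = 1 :=
  nonsing_inv_mul _ (isUnit_det_charTM A)

theorem X_smul_resolventTM (A : Matrix σ σ ℂ) :
    (RatFunc.X : RatFunc ℂ) • resolventTM A = 1 + constTM A * resolventTM A := by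
  have h := charTM_mul_resolventTM A
  rw [charTM, sub_mul, smul_mul_assoc, one_mul, sub_eq_iff_eq_add] at h
  exact h

theorem inv_proper_of_valInfty {M : TransferMatrix σ σ} (hM : EntriesIn properSubring M)
    (h : IsUnit (M.map valInfty).det) : EntriesIn properSubring M⁻¹ := by
  refine hM.inv (isProper_inv ?_)
  rw [valInfty_det hM]
  exact h.ne_zero

/-- The matrix `s (s I - A)⁻¹` is the inverse of `I - s⁻¹ A`, which is proper with value `I` at
infinity. Dividing by `s` then gives the claims on the resolvent itself. -/
theorem resolventTM_proper_aux (A : Matrix σ σ ℂ) :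
    EntriesIn properSubring (resolventTM A) ∧ (resolventTM A).map valInfty = 0 ∧
      EntriesIn properSubring ((RatFunc.X : RatFunc ℂ) • resolventTM A) ∧
      ((RatFunc.X : RatFunc ℂ) • resolventTM A).map valInfty = 1 := by
  have hX : (RatFunc.X : RatFunc ℂ) ≠ 0 := RatFunc.X_ne_zero
  set Y : TransferMatrix σ σ := (RatFunc.X : RatFunc ℂ) • resolventTM A with hY
  have hR : resolventTM A = (RatFunc.X : RatFunc ℂ)⁻¹ • Y := by rw [hY, inv_smul_smul₀ hX]
  set Z : TransferMatrix σ σ := 1 + (RatFunc.X : RatFunc ℂ)⁻¹ • constTM (-A) with hZ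
  have hS : EntriesIn properSubring ((RatFunc.X : RatFunc ℂ)⁻¹ • constTM (-A)) :=
    (entriesIn_proper_constTM _).smul IsProper.inv_X.1
  have hZp : EntriesIn properSubring Z := EntriesIn.one.add hS
  have hS0 : ((RatFunc.X : RatFunc ℂ)⁻¹ • constTM (-A)).map valInfty = 0 := by
    ext i j
    simp only [map_apply, Matrix.smul_apply, smul_eq_mul, Matrix.zero_apply]
    rw [(IsProper.inv_X.1.mul_valInfty (entriesIn_proper_constTM (-A) i j)).2, IsProper.inv_X.2,
      zero_mul]
  have hZ1 : Z.map valInfty = 1 := by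
    rw [hZ, map_valInfty_add EntriesIn.one hS, map_valInfty_one, hS0, add_zero]
  have hZY : Z * Y = 1 := by
    rw [← charTM_mul_resolventTM A, hY, hZ, Matrix.mul_smul, ← Matrix.smul_mul, smul_add,
      smul_inv_smul₀ hX, charTM, constTM_neg, sub_eq_add_neg]
  have hYp : EntriesIn properSubring Y := by
    rw [← inv_eq_right_inv hZY]
    exact inv_proper_of_valInfty hZp (by rw [hZ1]; simp)
  have hY1 : Y.map valInfty = 1 := by
    have := congrArg (fun T : TransferMatrix σ σ => T.map valInfty) hZY
    simpa [map_valInfty_mul hZp hYp, hZ1, map_valInfty_one] using this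
  refine ⟨hR ▸ hYp.smul IsProper.inv_X.1, ?_, hYp, hY1⟩
  ext i j
  rw [hR]
  simp only [map_apply, Matrix.smul_apply, smul_eq_mul, Matrix.zero_apply]
  rw [(IsProper.inv_X.1.mul_valInfty (hYp i j)).2, IsProper.inv_X.2, zero_mul]

theorem resolventTM_proper (A : Matrix σ σ ℂ) : EntriesIn properSubring (resolventTM A) :=
  (resolventTM_proper_aux A).1

theorem resolventTM_valInfty (A : Matrix σ σ ℂ) : (resolventTM A).map valInfty = 0 :=
  (resolventTM_proper_aux A).2.1

theorem isHurwitz_iff_charpoly {A : Matrix σ σ ℂ} :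
    IsHurwitz A ↔ ∀ s : ℂ, 0 ≤ s.re → A.charpoly.eval s ≠ 0 := by
  constructor
  · intro h s hs h0
    exact absurd (h s (mem_spectrum_iff_isRoot_charpoly.2 h0)) (not_lt.2 hs)
  · intro h z hz
    by_contra hn
    exact h z (not_lt.1 hn) (mem_spectrum_iff_isRoot_charpoly.1 hz)

theorem charTM_mem_regularAt (A : Matrix σ σ ℂ) (s : ℂ) : EntriesIn (regularAt s) (charTM A) := by
  intro i j
  rw [charTM_eq_map]
  exact algebraMap_mem_regularAt s _

/-- The determinant of the resolvent is the reciprocal of the characteristic polynomial, so no zero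
of the latter can be hidden by cancellation in all the entries. This turns Hurwitz claims into
membership in a ring. -/
theorem isHurwitz_iff_resolventTM {A : Matrix σ σ ℂ} :
    IsHurwitz A ↔ EntriesIn stableSubring (resolventTM A) := by
  rw [isHurwitz_iff_charpoly]
  constructor
  · refine fun h i j => ⟨resolventTM_proper A i j, fun s hs => ?_⟩
    refine (charTM_mem_regularAt A s).inv ?_ i j
    rw [det_charTM]
    exact (inv_algebraMap_mem_regularAt_iff A.charpoly_monic.ne_zero).2 (h s hs)
  · intro h s hs
    have h1 : EntriesIn (regularAt s) (resolventTM A) := fun i j => (h i j).2 s hs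
    rw [← inv_algebraMap_mem_regularAt_iff A.charpoly_monic.ne_zero, ← det_charTM]
    convert h1.det
    rw [resolventTM, det_nonsing_inv, Ring.inverse_eq_inv']

theorem entriesIn_stable_constTM (D : Matrix o ι ℂ) : EntriesIn stableSubring (constTM D) :=
  fun _ _ => C_mem_stableSubring _

theorem resolventTM_eq_of_charTM_mul {A : Matrix σ σ ℂ} {Y : TransferMatrix σ σ}
    (h : charTM A * Y = 1) : resolventTM A = Y := inv_eq_right_inv h

/-- An output injection in the resolvent. -/
theorem resolventTM_injection [Fintype o] (A : Matrix σ σ ℂ) (L : Matrix σ o ℂ)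
    (C : Matrix o σ ℂ) :
    resolventTM A = resolventTM (A + L * C)
      - resolventTM (A + L * C) * constTM L * (constTM C * resolventTM A) := by
  have h : charTM (A + L * C) = charTM A - constTM L * constTM C := by
    rw [charTM, charTM, constTM_add, constTM_mul, sub_sub]
  calc resolventTM A = resolventTM (A + L * C) * charTM (A + L * C) * resolventTM A := by
        rw [resolventTM_mul_charTM, Matrix.one_mul]
    _ = resolventTM (A + L * C) * (charTM A * resolventTM A)
          - resolventTM (A + L * C) * constTM L * (constTM C * resolventTM A) := by
        rw [h]
        simp only [Matrix.mul_assoc, Matrix.sub_mul, Matrix.mul_sub]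
    _ = _ := by rw [charTM_mul_resolventTM, Matrix.mul_one]

/-- A state feedback in the resolvent. -/
theorem resolventTM_feedback [Fintype ι] (A : Matrix σ σ ℂ) (B : Matrix σ ι ℂ)
    (F : Matrix ι σ ℂ) :
    resolventTM A = resolventTM (A + B * F)
      - resolventTM A * constTM B * (constTM F * resolventTM (A + B * F)) := by
  have h : charTM (A + B * F) = charTM A - constTM B * constTM F := by
    rw [charTM, charTM, constTM_add, constTM_mul, sub_sub]
  calc resolventTM A = resolventTM A * (charTM (A + B * F) * resolventTM (A + B * F)) := by
        rw [charTM_mul_resolventTM, Matrix.mul_one]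
    _ = (resolventTM A * charTM A) * resolventTM (A + B * F)
          - resolventTM A * constTM B * (constTM F * resolventTM (A + B * F)) := by
        rw [h]
        simp only [Matrix.mul_assoc, Matrix.sub_mul, Matrix.mul_sub]
    _ = _ := by rw [resolventTM_mul_charTM, Matrix.one_mul]

/-- A stabilizable and detectable realization of a stable transfer matrix is Hurwitz. -/
theorem isHurwitz_of_stable_transfer [Fintype ι] [Fintype o] {A : Matrix σ σ ℂ} {B : Matrix σ ι ℂ}
    {C : Matrix o σ ℂ} {F : Matrix ι σ ℂ} {L : Matrix σ o ℂ} (hF : IsHurwitz (A + B * F))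
    (hL : IsHurwitz (A + L * C))
    (hT : EntriesIn stableSubring (constTM C * resolventTM A * constTM B)) : IsHurwitz A := by
  rw [isHurwitz_iff_resolventTM] at hF hL ⊢
  -- Feedback writes `C (s I - A)⁻¹` in terms of the stable transfer matrix and a stable resolvent.
  -- Output injection below does the same for `(s I - A)⁻¹` in terms of `C (s I - A)⁻¹`.
  have hC : EntriesIn stableSubring (constTM C * resolventTM A) := by
    rw [resolventTM_feedback A B F, Matrix.mul_sub]
    refine ((entriesIn_stable_constTM C).mul hF).sub ?_
    rw [← Matrix.mul_assoc (constTM C) _ (constTM F * _), ← Matrix.mul_assoc (constTM C)]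
    exact hT.mul ((entriesIn_stable_constTM F).mul hF)
  rw [resolventTM_injection A L C]
  exact hL.sub ((hL.mul (entriesIn_stable_constTM L)).mul hC)

/-- The resolvents of similar matrices, and more generally of intertwined ones. -/
theorem resolventTM_intertwine {τ : Type} [Fintype τ] [DecidableEq τ] {A : Matrix σ σ ℂ}
    {A' : Matrix τ τ ℂ} {E : Matrix τ σ ℂ} (h : A' * E = E * A) :
    resolventTM A' * constTM E = constTM E * resolventTM A := by
  have h1 : charTM A' * constTM E = constTM E * charTM A := by
    rw [charTM, charTM, Matrix.sub_mul, Matrix.mul_sub, ← constTM_mul, ← constTM_mul, h]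
    simp
  calc resolventTM A' * constTM E
      = resolventTM A' * (constTM E * charTM A) * resolventTM A := by
        rw [Matrix.mul_assoc, Matrix.mul_assoc, charTM_mul_resolventTM, Matrix.mul_one]
    _ = _ := by rw [← h1, ← Matrix.mul_assoc, resolventTM_mul_charTM, Matrix.one_mul]

end Resolvent

/-! ### Transfer matrices of realizations -/

namespace StateSpace

variable {σ τ ι o : Type} [Fintype σ] [DecidableEq σ] [Fintype τ] [DecidableEq τ]

theorem transfer_eq (X : StateSpace σ ι o) :
    X.transfer = constTM X.C * resolventTM X.A * constTM X.B + constTM X.D := rfl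

theorem strictlyProper (X : StateSpace σ ι o) :
    EntriesIn properSubring (constTM X.C * resolventTM X.A * constTM X.B) ∧
      (constTM X.C * resolventTM X.A * constTM X.B).map valInfty = 0 := by
  have h1 := (entriesIn_proper_constTM X.C).mul (resolventTM_proper X.A)
  refine ⟨h1.mul (entriesIn_proper_constTM X.B), ?_⟩
  rw [map_valInfty_mul h1 (entriesIn_proper_constTM X.B),
    map_valInfty_mul (entriesIn_proper_constTM X.C) (resolventTM_proper X.A),
    resolventTM_valInfty]
  simp

theorem hasFeedthrough_transfer (X : StateSpace σ ι o) : HasFeedthrough X.transfer X.D := by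
  obtain ⟨h1, h2⟩ := X.strictlyProper
  rw [transfer_eq]
  refine ⟨h1.add (entriesIn_proper_constTM X.D), ?_⟩
  rw [map_valInfty_add h1 (entriesIn_proper_constTM X.D), h2, map_valInfty_constTM, zero_add]

theorem D_eq_of_transfer_eq {X : StateSpace σ ι o} {Y : StateSpace τ ι o}
    (h : X.transfer = Y.transfer) : X.D = Y.D := by
  rw [← X.hasFeedthrough_transfer.2, h, Y.hasFeedthrough_transfer.2]

theorem X_smul_resolvent_valInfty (X : StateSpace σ ι o) :
    ((RatFunc.X : RatFunc ℂ) • (constTM X.C * resolventTM X.A * constTM X.B)).map valInfty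
      = X.C * X.B := by
  obtain ⟨-, -, h3, h4⟩ := resolventTM_proper_aux X.A
  rw [← Matrix.smul_mul, ← Matrix.mul_smul,
    map_valInfty_mul ((entriesIn_proper_constTM X.C).mul h3) (entriesIn_proper_constTM X.B),
    map_valInfty_mul (entriesIn_proper_constTM X.C) h3, h4]
  simp [map_valInfty_constTM]

/-- The Markov parameters are determined by the transfer matrix. -/
theorem markov_eq_of_transfer_eq {X : StateSpace σ ι o} {Y : StateSpace τ ι o}
    (h : X.transfer = Y.transfer) (k : ℕ) : X.C * X.A ^ k * X.B = Y.C * Y.A ^ k * Y.B := by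
  have hD := D_eq_of_transfer_eq h
  rw [transfer_eq, transfer_eq, hD, add_left_inj] at h
  -- The Markov parameter is read off as the value at infinity after multiplication by `s`.
  -- Subtracting it leaves the same expression with one more power of `A`, hence the induction.
  have step : ∀ k, constTM (X.C * X.A ^ k) * resolventTM X.A * constTM X.B =
      constTM (Y.C * Y.A ^ k) * resolventTM Y.A * constTM Y.B →
      X.C * X.A ^ k * X.B = Y.C * Y.A ^ k * Y.B := by
    intro k hk
    have h1 := X_smul_resolvent_valInfty ⟨X.A, X.B, X.C * X.A ^ k, X.D⟩
    have h2 := X_smul_resolvent_valInfty ⟨Y.A, Y.B, Y.C * Y.A ^ k, Y.D⟩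
    simp only at h1 h2
    rw [← h1, ← h2, hk]
  have shift : ∀ {σ : Type} [Fintype σ] [DecidableEq σ] (Z : StateSpace σ ι o) (k : ℕ),
      constTM (Z.C * Z.A ^ (k + 1)) * resolventTM Z.A * constTM Z.B =
        (RatFunc.X : RatFunc ℂ) • (constTM (Z.C * Z.A ^ k) * resolventTM Z.A * constTM Z.B)
          - constTM (Z.C * Z.A ^ k * Z.B) := by
    intro σ _ _ Z k
    rw [← Matrix.smul_mul, ← Matrix.mul_smul, X_smul_resolventTM, pow_succ, ← Matrix.mul_assoc,
      constTM_mul (Z.C * Z.A ^ k) Z.A, constTM_mul _ Z.B, Matrix.mul_add, Matrix.add_mul,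
      Matrix.mul_one]
    simp only [Matrix.mul_assoc]
    abel
  have main : ∀ k, constTM (X.C * X.A ^ k) * resolventTM X.A * constTM X.B =
      constTM (Y.C * Y.A ^ k) * resolventTM Y.A * constTM Y.B := by
    intro k
    induction k with
    | zero => simpa using h
    | succ k ih => rw [shift, shift, ih, step k ih]
  exact step k (main k)

/-- A realization embedded by `E` into another one has the same transfer matrix. -/
theorem transfer_eq_of_intertwine {X : StateSpace σ ι o} {Y : StateSpace τ ι o} (E : Matrix τ σ ℂ)
    (hA : Y.A * E = E * X.A) (hB : Y.B = E * X.B) (hC : Y.C * E = X.C) (hD : Y.D = X.D) :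
    Y.transfer = X.transfer := by
  rw [transfer_eq, transfer_eq, hB, hD, ← hC, constTM_mul, constTM_mul, Matrix.mul_assoc _ (constTM E),
    ← resolventTM_intertwine hA]
  simp only [Matrix.mul_assoc]

end StateSpace

/-! ### The Youla-Kucera parameterization -/

section Youla

variable {κ : Type} [Fintype κ] [DecidableEq κ]

namespace IsDoublyCoprime

variable {P N M N' M' U V U' V' : TransferMatrix κ κ}

theorem bezout_blocks (h : IsDoublyCoprime P N M N' M' U V U' V') :
    V' * M - U' * N = 1 ∧ V' * U - U' * V = 0 ∧ -(N' * M) + M' * N = 0 ∧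
      -(N' * U) + M' * V = 1 := by
  have := h.bezout
  rw [fromBlocks_multiply, ← fromBlocks_one, fromBlocks_inj] at this
  simpa [sub_eq_add_neg] using this

/-- A parameter in `RH_∞` turns Bezout factors into Bezout factors. -/
theorem shift (h : IsDoublyCoprime P N M N' M' U V U' V') {Q : TransferMatrix κ κ}
    (hQ : IsRHInf Q) :
    IsDoublyCoprime P N M N' M' (U + M * Q) (V + N * Q) (U' + Q * M') (V' + Q * N') where
  N_stable := h.N_stable
  M_stable := h.M_stable
  N'_stable := h.N'_stable
  M'_stable := h.M'_stable
  U_stable := EntriesIn.add (S := stableSubring) h.U_stable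
    (EntriesIn.mul (S := stableSubring) h.M_stable hQ)
  V_stable := EntriesIn.add (S := stableSubring) h.V_stable
    (EntriesIn.mul (S := stableSubring) h.N_stable hQ)
  U'_stable := EntriesIn.add (S := stableSubring) h.U'_stable
    (EntriesIn.mul (S := stableSubring) hQ h.M'_stable)
  V'_stable := EntriesIn.add (S := stableSubring) h.V'_stable
    (EntriesIn.mul (S := stableSubring) hQ h.N'_stable)
  M_det := h.M_det
  M'_det := h.M'_det
  right_fact := h.right_fact
  left_fact := h.left_fact
  bezout := by
    -- The outer triangular factors are inverse to each other, and the old Bezout product between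
    -- them is the identity.
    have e1 : fromBlocks (V' + Q * N') (-(U' + Q * M')) (-N') M' =
        fromBlocks 1 (-Q) 0 1 * fromBlocks V' (-U') (-N') M' := by
      rw [fromBlocks_multiply]
      simp [add_comm]
    have e2 : fromBlocks M (U + M * Q) N (V + N * Q) =
        fromBlocks M U N V * fromBlocks 1 Q 0 1 := by
      rw [fromBlocks_multiply]
      simp [add_comm]
    rw [e1, e2, Matrix.mul_assoc, ← Matrix.mul_assoc (fromBlocks V' (-U') (-N') M'), h.bezout,
      Matrix.one_mul, fromBlocks_multiply]
    simp

/-- From `V' U = U' V` comes `V' (U V⁻¹) = U'`. Inserted in `V' M - U' N = 1`, this exhibits `M - U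
V⁻¹ N` as an inverse of `V'`. -/
theorem left_coprime_controller (h : IsDoublyCoprime P N M N' M' U V U' V') (hV : V.det ≠ 0) :
    V'.det ≠ 0 ∧ U * V⁻¹ = V'⁻¹ * U' := by
  obtain ⟨h1, h2, -, -⟩ := h.bezout_blocks
  have hVu : IsUnit V.det := hV.isUnit
  have h3 : V' * (U * V⁻¹) = U' := by
    rw [← Matrix.mul_assoc, sub_eq_zero.1 h2, Matrix.mul_assoc, mul_nonsing_inv _ hVu,
      Matrix.mul_one]
  have hV' : IsUnit V'.det := by
    refine isUnit_det_of_right_inverse (B := M - U * V⁻¹ * N) ?_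
    rw [Matrix.mul_sub, ← Matrix.mul_assoc, h3, h1]
  refine ⟨hV'.ne_zero, ?_⟩
  rw [← h3, ← Matrix.mul_assoc, nonsing_inv_mul _ hV', Matrix.one_mul]

/-- Since `M = U V⁻¹ N + V'⁻¹`, the numerator `U + M Q` is `U V⁻¹ (V + N Q) + V'⁻¹ Q`. The
denominator factors as `V (1 + V⁻¹ N Q)`. -/
theorem controller_eq_lowerLFT (h : IsDoublyCoprime P N M N' M' U V U' V') (hV : V.det ≠ 0)
    {Q : TransferMatrix κ κ} (hVQ : (V + N * Q).det ≠ 0) :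
    (1 - -(V⁻¹ * N) * Q).det ≠ 0 ∧
      youla N M U V Q = lowerLFT (U * V⁻¹) V'⁻¹ V⁻¹ (-(V⁻¹ * N)) Q := by
  obtain ⟨h1, -, -, -⟩ := h.bezout_blocks
  obtain ⟨hV', h2⟩ := h.left_coprime_controller hV
  have hVu : IsUnit V.det := hV.isUnit
  have hfac : V + N * Q = V * (1 - -(V⁻¹ * N) * Q) := by
    rw [Matrix.mul_sub, Matrix.neg_mul, Matrix.mul_neg, sub_neg_eq_add, Matrix.mul_one,
      ← Matrix.mul_assoc, ← Matrix.mul_assoc, mul_nonsing_inv _ hVu, Matrix.one_mul]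
  have hdet : (1 - -(V⁻¹ * N) * Q).det ≠ 0 := by
    rw [hfac, det_mul] at hVQ
    exact right_ne_zero_of_mul hVQ
  refine ⟨hdet, ?_⟩
  have h3 : M - U * V⁻¹ * N = V'⁻¹ := by
    have := congrArg (V'⁻¹ * ·) h1
    simp only [Matrix.mul_sub, ← Matrix.mul_assoc, nonsing_inv_mul _ hV'.isUnit, Matrix.one_mul,
      Matrix.mul_one] at this
    rw [h2, this]
  have h4 : U + M * Q = U * V⁻¹ * (V + N * Q) + V'⁻¹ * Q := by
    rw [← h3, Matrix.mul_add, Matrix.mul_assoc U, nonsing_inv_mul _ hVu, Matrix.sub_mul]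
    simp only [Matrix.mul_one, Matrix.mul_assoc]
    abel
  rw [youla, h4, Matrix.add_mul, Matrix.mul_assoc _ (V + N * Q), mul_nonsing_inv _ hVQ.isUnit,
    Matrix.mul_one, lowerLFT, hfac, Matrix.mul_inv_rev]
  simp only [Matrix.mul_assoc]

/-- The loop with the controller `U V⁻¹` is stable. -/
theorem loop_stable (h : IsDoublyCoprime P N M N' M' U V U' V') (hV : V.det ≠ 0) :
    (1 - P * (U * V⁻¹)).det ≠ 0 ∧
      IsRHInf (fromBlocks 1 (-(U * V⁻¹)) (-P) 1 : TransferMatrix (κ ⊕ κ) (κ ⊕ κ))⁻¹ := by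
  obtain ⟨hV', h2⟩ := h.left_coprime_controller hV
  have e : (fromBlocks 1 (-(U * V⁻¹)) (-P) 1 : TransferMatrix (κ ⊕ κ) (κ ⊕ κ)) =
      fromBlocks V'⁻¹ 0 0 M'⁻¹ * fromBlocks V' (-U') (-N') M' := by
    rw [fromBlocks_multiply, h2, h.left_fact]
    simp [nonsing_inv_mul _ hV'.isUnit, nonsing_inv_mul _ h.M'_det.isUnit]
  have hmul : (fromBlocks 1 (-(U * V⁻¹)) (-P) 1 : TransferMatrix (κ ⊕ κ) (κ ⊕ κ)) *
      (fromBlocks M U N V * fromBlocks V' 0 0 M') = 1 := by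
    rw [e, Matrix.mul_assoc, ← Matrix.mul_assoc (fromBlocks V' (-U') (-N') M'), h.bezout,
      Matrix.one_mul, fromBlocks_multiply, ← fromBlocks_one]
    simp [nonsing_inv_mul _ hV'.isUnit, nonsing_inv_mul _ h.M'_det.isUnit]
  constructor
  · have := (isUnit_det_of_right_inverse hmul).ne_zero
    rw [det_fromBlocks_one₁₁] at this
    simpa using this
  · rw [inv_eq_right_inv hmul]
    exact EntriesIn.mul (S := stableSubring)
      (EntriesIn.fromBlocks h.M_stable h.U_stable h.N_stable h.V_stable)
      (EntriesIn.fromBlocks h.V'_stable EntriesIn.zero EntriesIn.zero h.M'_stable)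

end IsDoublyCoprime

end Youla

/-! ### Internal stability of feedback loops -/

section Loop

variable {σ τ κ : Type} [Fintype σ] [DecidableEq σ] [Fintype τ] [DecidableEq τ]

theorem IsHurwitz.fromBlocks {A : Matrix σ σ ℂ} {A' : Matrix τ τ ℂ} (h : IsHurwitz A)
    (h' : IsHurwitz A') : IsHurwitz (fromBlocks A 0 0 A') := by
  rw [isHurwitz_iff_charpoly] at *
  intro s hs
  rw [charpoly_fromBlocks_zero₁₂, Polynomial.eval_mul]
  exact mul_ne_zero (h s hs) (h' s hs)

theorem resolventTM_fromBlocks (A : Matrix σ σ ℂ) (A' : Matrix τ τ ℂ) :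
    resolventTM (fromBlocks A 0 0 A') = fromBlocks (resolventTM A) 0 0 (resolventTM A') := by
  apply resolventTM_eq_of_charTM_mul
  have : charTM (fromBlocks A 0 0 A') = fromBlocks (charTM A) 0 0 (charTM A') := by
    rw [charTM, constTM_fromBlocks, ← fromBlocks_one, fromBlocks_smul, sub_eq_add_neg,
      fromBlocks_neg, fromBlocks_add]
    simp [charTM, sub_eq_add_neg]
  rw [this, fromBlocks_multiply, ← fromBlocks_one]
  simp [charTM_mul_resolventTM]

variable [Fintype κ] [DecidableEq κ]

/-- The closed loop is the direct sum of the two systems under a constant output feedback, so it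
stays stabilizable and detectable. Its transfer matrix is a stable expression in the inverse of the
loop matrix, so no unstable mode can remain. -/
theorem internallyStable_of_loop_stable {X : StateSpace σ κ κ} {Y : StateSpace τ κ κ}
    (hXs : X.Stabilizable) (hXd : X.Detectable) (hYs : Y.Stabilizable) (hYd : Y.Detectable)
    (hdet : (1 - X.transfer * Y.transfer).det ≠ 0)
    (hstab : IsRHInf (fromBlocks 1 (-Y.transfer) (-X.transfer) 1 :
      TransferMatrix (κ ⊕ κ) (κ ⊕ κ))⁻¹) : InternallyStable X Y := by
  set T : TransferMatrix (κ ⊕ κ) (κ ⊕ κ) := fromBlocks 1 (-Y.transfer) (-X.transfer) 1 with hT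
  have hTdet : IsUnit T.det := by
    rw [hT, det_fromBlocks_one₁₁]
    simpa using hdet
  have hTT : T * T⁻¹ = 1 := mul_nonsing_inv _ hTdet
  have hTp : EntriesIn properSubring T := EntriesIn.fromBlocks EntriesIn.one
    (EntriesIn.neg Y.hasFeedthrough_transfer.1) (EntriesIn.neg X.hasFeedthrough_transfer.1)
    EntriesIn.one
  have hneg : ∀ {σ : Type} [Fintype σ] [DecidableEq σ] (Z : StateSpace σ κ κ),
      (-Z.transfer).map valInfty = -Z.D := by
    intro σ _ _ Z
    have h1 := map_valInfty_add (EntriesIn.neg Z.hasFeedthrough_transfer.1)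
      (Z.hasFeedthrough_transfer.1 : EntriesIn properSubring _)
    rw [neg_add_cancel, Z.hasFeedthrough_transfer.2, Matrix.map_zero _ valInfty_zero] at h1
    exact eq_neg_of_add_eq_zero_left h1.symm
  set T₀ : Matrix (κ ⊕ κ) (κ ⊕ κ) ℂ := fromBlocks 1 (-Y.D) (-X.D) 1 with hT₀
  have hTv : T.map valInfty = T₀ := by
    rw [hT, fromBlocks_map, hneg, hneg, map_valInfty_one]
  -- Well-posedness: a stable inverse is proper, so the identity `T T⁻¹ = 1` can be evaluated at
  -- infinity.
  have hT₀T : T₀ * (T⁻¹).map valInfty = 1 := by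
    rw [← hTv, ← map_valInfty_mul hTp (EntriesIn.mono stableSubring_le_properSubring hstab), hTT,
      map_valInfty_one]
  have hT₀det : IsUnit T₀.det := isUnit_det_of_right_inverse hT₀T
  refine ⟨?_, ?_⟩
  · rw [hT₀, det_fromBlocks_one₁₁] at hT₀det
    simpa using hT₀det
  obtain ⟨FX, hFX⟩ := hXs
  obtain ⟨FY, hFY⟩ := hYs
  obtain ⟨LX, hLX⟩ := hXd
  obtain ⟨LY, hLY⟩ := hYd
  set A₀ := fromBlocks X.A 0 0 Y.A with hA₀
  set B₀ := fromBlocks X.B 0 0 Y.B with hB₀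
  set C₀ := fromBlocks X.C 0 0 Y.C with hC₀
  set W : Matrix (κ ⊕ κ) (κ ⊕ κ) ℂ := fromBlocks 0 1 1 0 with hW
  have hWW : W * W = 1 := by
    rw [hW, fromBlocks_multiply, ← fromBlocks_one]
    simp
  have hcl : closedLoopA X Y = A₀ + B₀ * (T₀⁻¹ * W * C₀) := by
    have : W * C₀ = fromBlocks 0 Y.C X.C 0 := by
      rw [hW, hC₀, fromBlocks_multiply]
      simp
    rw [Matrix.mul_assoc _ W, this, closedLoopA, ← Matrix.mul_assoc]
  -- The feedback gain first cancels the loop and then stabilizes each system separately. The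
  -- injection gain below is chosen in the same way.
  have hF : IsHurwitz (closedLoopA X Y + B₀ * (fromBlocks FX 0 0 FY - T₀⁻¹ * W * C₀)) := by
    have : closedLoopA X Y + B₀ * (fromBlocks FX 0 0 FY - T₀⁻¹ * W * C₀) =
        fromBlocks (X.A + X.B * FX) 0 0 (Y.A + Y.B * FY) := by
      rw [hcl, Matrix.mul_sub, add_assoc, add_sub_cancel, hB₀, fromBlocks_multiply, hA₀,
        fromBlocks_add]
      simp
    rw [this]
    exact hFX.fromBlocks hFY
  have hL : IsHurwitz (closedLoopA X Y + (fromBlocks LX 0 0 LY - B₀ * (T₀⁻¹ * W)) * C₀) := by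
    have : closedLoopA X Y + (fromBlocks LX 0 0 LY - B₀ * (T₀⁻¹ * W)) * C₀ =
        fromBlocks (X.A + LX * X.C) 0 0 (Y.A + LY * Y.C) := by
      rw [hcl, Matrix.sub_mul, ← Matrix.mul_assoc, add_assoc, add_sub_cancel, hC₀,
        fromBlocks_multiply, hA₀, fromBlocks_add]
      simp
    rw [this]
    exact hLX.fromBlocks hLY
  refine isHurwitz_of_stable_transfer hF hL ?_
  set Gc := constTM C₀ * resolventTM (closedLoopA X Y) * constTM B₀ with hGc
  -- Apart from signs and the exchange `W`, the off-diagonal blocks of `T - T₀` are the strictly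
  -- proper parts of the two open-loop transfer matrices.
  have hG : constTM W * (constTM C₀ * resolventTM A₀ * constTM B₀) = constTM T₀ - T := by
    rw [hW, hC₀, hB₀, hA₀, resolventTM_fromBlocks, constTM_fromBlocks, constTM_fromBlocks,
      constTM_fromBlocks, fromBlocks_multiply, fromBlocks_multiply, fromBlocks_multiply, hT₀, hT,
      constTM_fromBlocks, sub_eq_add_neg, fromBlocks_neg, fromBlocks_add, X.transfer_eq,
      Y.transfer_eq]
    simp
  have hfb : constTM C₀ * resolventTM A₀ * constTM B₀ =
      Gc - constTM C₀ * resolventTM A₀ * constTM B₀ * (constTM T₀⁻¹ * constTM W * Gc) := by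
    have := congrArg (fun Z => constTM C₀ * Z * constTM B₀)
      (resolventTM_feedback A₀ B₀ (T₀⁻¹ * W * C₀))
    simp only [Matrix.mul_sub, Matrix.sub_mul, ← hcl, constTM_mul] at this
    rw [hGc]
    simpa only [Matrix.mul_assoc] using this
  have hTi : constTM T₀ * constTM T₀⁻¹ = 1 := by
    rw [← constTM_mul, mul_nonsing_inv _ hT₀det, constTM_one]
  -- Left multiplication of the feedback identity by `W` expresses its open-loop terms through `T`.
  -- Solving for `Gc` then leaves only constants and `T⁻¹`.
  have key : T * (constTM T₀⁻¹ * (constTM W * Gc)) = constTM T₀ - T := by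
    have h1 := congrArg (constTM W * ·) hfb
    simp only [Matrix.mul_sub] at h1
    rw [← Matrix.mul_assoc (constTM W) (constTM C₀ * _ * _), hG, Matrix.sub_mul, Matrix.mul_assoc
      (constTM T₀⁻¹), ← Matrix.mul_assoc (constTM T₀), hTi, Matrix.one_mul] at h1
    rw [h1]
    abel
  have hWG : Gc = constTM W * (constTM T₀ * (T⁻¹ * constTM T₀ - 1)) := by
    have h1 : constTM T₀⁻¹ * (constTM W * Gc) = T⁻¹ * constTM T₀ - 1 := by
      have := congrArg (T⁻¹ * ·) key
      simp only [Matrix.mul_sub] at this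
      rwa [← Matrix.mul_assoc, nonsing_inv_mul _ hTdet, Matrix.one_mul] at this
    rw [← h1, ← Matrix.mul_assoc (constTM T₀), hTi, Matrix.one_mul, ← Matrix.mul_assoc,
      ← constTM_mul, hWW, constTM_one, Matrix.one_mul]
  rw [hWG]
  exact (entriesIn_stable_constTM W).mul ((entriesIn_stable_constTM T₀).mul
    ((EntriesIn.mul (S := stableSubring) hstab (entriesIn_stable_constTM T₀)).sub EntriesIn.one))

end Loop

theorem OpenOscillator.stateSpace22_transfer {ν ρ κ : Type} [Fintype ν] [DecidableEq ν] [Fintype ρ]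
    [DecidableEq ρ] [Fintype κ] [DecidableEq κ] (G : OpenOscillator ν (ρ ⊕ κ)) :
    G.stateSpace22.transfer = G.modifiedPlant.toBlocks₂₂ := by
  ext (i | i) (j | j) <;> rfl

/-! ### Entrywise conjugation and the exchange of a doubled-up signal's halves -/

section Conj

variable {o ι κ : Type}

/-- Entrywise complex conjugation. -/
def conjM (M : Matrix o ι ℂ) : Matrix o ι ℂ := M.map (starRingEnd ℂ)

theorem conjM_mul [Fintype ι] (M : Matrix o ι ℂ) (N : Matrix ι κ ℂ) :
    conjM (M * N) = conjM M * conjM N := Matrix.map_mul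

theorem conjM_add (M N : Matrix o ι ℂ) : conjM (M + N) = conjM M + conjM N :=
  Matrix.map_add _ (map_add _) M N

theorem conjM_smul (c : ℂ) (M : Matrix o ι ℂ) : conjM (c • M) = starRingEnd ℂ c • conjM M := by
  ext i j
  simp [conjM]

theorem conjM_neg (M : Matrix o ι ℂ) : conjM (-M) = -conjM M := by
  ext i j
  simp [conjM]

theorem conjM_one [DecidableEq ι] : conjM (1 : Matrix ι ι ℂ) = 1 :=
  Matrix.map_one _ (map_zero _) (map_one _)

theorem conjM_zero : conjM (0 : Matrix o ι ℂ) = 0 := Matrix.map_zero _ (map_zero _)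

theorem conjM_conjM (M : Matrix o ι ℂ) : conjM (conjM M) = M := by
  ext i j
  simp [conjM]

theorem conjM_conjTranspose (M : Matrix o ι ℂ) : conjM Mᴴ = (conjM M)ᴴ := by
  ext i j
  simp [conjM]

variable [DecidableEq κ]

/-- The exchange of the two halves of a doubled-up vector. -/
def swapM (κ : Type) [DecidableEq κ] (R : Type) [Ring R] : Matrix (κ ⊕ κ) (κ ⊕ κ) R :=
  fromBlocks 0 1 1 0

theorem conjM_swapM : conjM (swapM κ ℂ) = swapM κ ℂ := by
  rw [swapM, conjM, fromBlocks_map]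
  simp

theorem constTM_swapM : constTM (swapM κ ℂ) = swapM κ (RatFunc ℂ) := by
  rw [swapM, constTM_fromBlocks]
  simp [swapM]

theorem conjTranspose_swapM : (swapM κ ℂ)ᴴ = swapM κ ℂ := by
  rw [swapM, fromBlocks_conjTranspose]
  simp

theorem conjM_sigJ : conjM (sigJ κ ℂ) = sigJ κ ℂ := by
  rw [sigJ, conjM, fromBlocks_map]
  congr 1
  · simp
  · simp
  · simp
  · exact (conjM_neg _).trans (by rw [conjM_one])

theorem constTM_sigJ : constTM (sigJ κ ℂ) = sigJ κ (RatFunc ℂ) := by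
  rw [sigJ, constTM_fromBlocks]
  simp [sigJ]

theorem conjTranspose_sigJ : (sigJ κ ℂ)ᴴ = sigJ κ ℂ := by
  rw [sigJ, fromBlocks_conjTranspose]
  simp

variable [Fintype κ]

theorem swapM_mul_swapM {R : Type} [Ring R] : swapM κ R * swapM κ R = 1 := by
  rw [swapM, fromBlocks_multiply, ← fromBlocks_one]
  simp

theorem sigJ_mul_sigJ {R : Type} [Ring R] : sigJ κ R * sigJ κ R = 1 := by
  rw [sigJ, fromBlocks_multiply, ← fromBlocks_one]
  simp

theorem swapM_mul_sigJ_mul_swapM : swapM κ ℂ * sigJ κ ℂ * swapM κ ℂ = -sigJ κ ℂ := by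
  rw [swapM, sigJ, fromBlocks_multiply, fromBlocks_multiply, fromBlocks_neg]
  simp

end Conj

/-! ### Conjugations of transfer matrices -/

section Conjugation

variable {σ o ι κ : Type}

theorem ratConj_algebraMap (p : Polynomial ℂ) :
    ratConj (algebraMap _ (RatFunc ℂ) p) = algebraMap _ (RatFunc ℂ) (polyConj p) := by
  have := RatFunc.map_apply_div (φ := polyConj) (hφ :=
    nonZeroDivisors_le_comap_nonZeroDivisors_of_injective _ polyConj_injective) p 1
  rw [ratConj, RatFunc.coe_mapRingHom_eq_coe_map]
  simpa using this

theorem ratNeg_algebraMap (p : Polynomial ℂ) :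
    ratNeg (algebraMap _ (RatFunc ℂ) p) = algebraMap _ (RatFunc ℂ) (polyNeg p) := by
  have := RatFunc.map_apply_div (φ := polyNeg) (hφ :=
    nonZeroDivisors_le_comap_nonZeroDivisors_of_injective _ polyNeg_injective) p 1
  rw [ratNeg, RatFunc.coe_mapRingHom_eq_coe_map]
  simpa using this

@[simp] theorem ratConj_C (c : ℂ) : ratConj (RatFunc.C c) = RatFunc.C (starRingEnd ℂ c) := by
  rw [← RatFunc.algebraMap_C, ratConj_algebraMap, ← RatFunc.algebraMap_C]
  simp [polyConj]

@[simp] theorem ratConj_X : ratConj RatFunc.X = RatFunc.X := by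
  rw [← RatFunc.algebraMap_X, ratConj_algebraMap]
  simp [polyConj]

@[simp] theorem ratNeg_C (c : ℂ) : ratNeg (RatFunc.C c) = RatFunc.C c := by
  rw [← RatFunc.algebraMap_C, ratNeg_algebraMap]
  simp [polyNeg]

@[simp] theorem ratNeg_X : ratNeg RatFunc.X = -RatFunc.X := by
  rw [← RatFunc.algebraMap_X, ratNeg_algebraMap]
  simp [polyNeg]

theorem ratConj_ratConj (f : RatFunc ℂ) : ratConj (ratConj f) = f := by
  have h : ∀ p : Polynomial ℂ, polyConj (polyConj p) = p := by
    intro p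
    ext n
    simp [polyConj]
  rw [← RatFunc.num_div_denom f]
  simp only [map_div₀, ratConj_algebraMap, h]

theorem map_ratConj_constTM (M : Matrix o ι ℂ) : (constTM M).map ratConj = constTM (conjM M) := by
  ext i j
  simp [constTM, conjM]

theorem sysConj_constTM (M : Matrix o ι ℂ) : sysConj (constTM M) = constTM Mᴴ := by
  ext i j
  simp [sysConj, constTM]

theorem sysConj_mul [Fintype ι] (M : TransferMatrix o ι) (N : TransferMatrix ι κ) :
    sysConj (M * N) = sysConj N * sysConj M := by
  have h := Matrix.map_mul (L := M) (M := N) (f := ratConj.comp ratNeg)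
  have := congrArg transpose h
  rw [transpose_mul] at this
  exact this

theorem sysConj_add (M N : TransferMatrix o ι) : sysConj (M + N) = sysConj M + sysConj N := by
  ext i j
  simp [sysConj]

variable [Fintype σ] [DecidableEq σ]

theorem map_ratConj_resolventTM (A : Matrix σ σ ℂ) :
    (resolventTM A).map ratConj = resolventTM (conjM A) := by
  symm
  apply resolventTM_eq_of_charTM_mul
  have h : charTM (conjM A) = (charTM A).map ratConj := by
    ext i j
    by_cases hij : i = j
    · subst hij
      simp [charTM, constTM, conjM]
    · simp [charTM, constTM, conjM, hij]
  rw [h, ← Matrix.map_mul, charTM_mul_resolventTM]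
  exact Matrix.map_one _ (map_zero _) (map_one _)

/-- Under the system conjugate `s I - A` becomes `-s I - A^*`, so the conjugate system has state
matrix `-A^*`. Its spectrum is the one that genericity keeps away from that of `A`. -/
theorem sysConj_resolventTM (A : Matrix σ σ ℂ) :
    sysConj (resolventTM A) = -resolventTM (-Aᴴ) := by
  have h : sysConj (charTM A) = -charTM (-Aᴴ) := by
    ext i j
    by_cases hij : i = j
    · subst hij
      simp [charTM, constTM, sysConj]
      ring
    · simp [charTM, constTM, sysConj, hij, Ne.symm hij]
  have h1 : sysConj (charTM A) * sysConj (resolventTM A) = 1 := by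
    rw [← sysConj_mul, resolventTM_mul_charTM, ← constTM_one, sysConj_constTM]
    simp
  rw [h, Matrix.neg_mul, ← Matrix.mul_neg] at h1
  rw [resolventTM_eq_of_charTM_mul h1, neg_neg]

theorem StateSpace.map_ratConj_transfer (X : StateSpace σ ι o) :
    X.transfer.map ratConj =
      StateSpace.transfer ⟨conjM X.A, conjM X.B, conjM X.C, conjM X.D⟩ := by
  rw [transfer_eq, transfer_eq, Matrix.map_add _ (map_add _), Matrix.map_mul, Matrix.map_mul,
    map_ratConj_constTM, map_ratConj_constTM, map_ratConj_constTM, map_ratConj_resolventTM]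

theorem StateSpace.sysConj_transfer (X : StateSpace σ ι o) :
    sysConj X.transfer =
      -(constTM X.Bᴴ * resolventTM (-X.Aᴴ) * constTM X.Cᴴ) + constTM X.Dᴴ := by
  rw [transfer_eq, sysConj_add, sysConj_constTM]
  congr 1
  rw [sysConj_mul, sysConj_mul, sysConj_resolventTM, sysConj_constTM, sysConj_constTM]
  simp [Matrix.mul_assoc]

/-- The doubled-up form as a symmetry, which can be transported to state space. -/
theorem IsDoubledUp.swap_conj [Fintype κ] [DecidableEq κ] {T : TransferMatrix (κ ⊕ κ) (κ ⊕ κ)}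
    (h : IsDoubledUp T) :
    swapM κ (RatFunc ℂ) * T.map ratConj * swapM κ (RatFunc ℂ) = T := by
  obtain ⟨R₁, R₂, rfl⟩ := h
  have hc : ∀ R : TransferMatrix κ κ, (R.map ratConj).map ratConj = R := by
    intro R
    ext i j
    simp [ratConj_ratConj]
  rw [fromBlocks_map, swapM, fromBlocks_multiply, fromBlocks_multiply, hc, hc]
  simp

end Conjugation

/-! ### Minimal realizations -/

section Minimal

variable {σ τ ι o κ : Type} [Fintype σ] [DecidableEq σ] [Fintype τ] [DecidableEq τ]

theorem pow_intertwine {A : Matrix σ σ ℂ} {A' : Matrix τ τ ℂ} {E : Matrix τ σ ℂ}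
    (h : A' * E = E * A) (k : ℕ) : A' ^ k * E = E * A ^ k := by
  induction k with
  | zero => simp
  | succ k ih => rw [pow_succ, Matrix.mul_assoc, h, ← Matrix.mul_assoc, ih, Matrix.mul_assoc,
      ← pow_succ]

namespace StateSpace

/-- The reachable states separate linear maps; this is equivalent to controllability. -/
def Separating (X : StateSpace σ ι o) : Prop :=
  ∀ (υ : Type) (M : Matrix υ σ ℂ), (∀ k : ℕ, M * X.A ^ k * X.B = 0) → M = 0

/-- Matrices of states that produce no output vanish; this is equivalent to observability. -/
def Distinguishing (X : StateSpace σ ι o) : Prop :=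
  ∀ (υ : Type) (M : Matrix σ υ ℂ), (∀ k : ℕ, X.C * X.A ^ k * M = 0) → M = 0

theorem Controllable.separating [Fintype ι] {X : StateSpace σ ι o} (h : X.Controllable) :
    X.Separating := by
  intro υ M hM
  have hle : (⨆ k : ℕ, LinearMap.range (X.A ^ k * X.B).mulVecLin) ≤ LinearMap.ker M.mulVecLin := by
    refine iSup_le fun k => ?_
    rintro _ ⟨v, rfl⟩
    rw [LinearMap.mem_ker, mulVecLin_apply, mulVecLin_apply, mulVec_mulVec, ← Matrix.mul_assoc,
      hM, zero_mulVec]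
  rw [h, top_le_iff] at hle
  ext i j
  have : Pi.single j 1 ∈ LinearMap.ker M.mulVecLin := hle ▸ Submodule.mem_top
  have := congrFun (LinearMap.mem_ker.1 this) i
  simpa using this

theorem Observable.distinguishing {X : StateSpace σ ι o} (h : X.Observable) :
    X.Distinguishing := by
  intro υ M hM
  ext i j
  have hv : M.col j ∈ ⨅ k : ℕ, LinearMap.ker (X.C * X.A ^ k).mulVecLin := by
    rw [Submodule.mem_iInf]
    intro k
    rw [LinearMap.mem_ker, mulVecLin_apply]
    ext l
    exact congrFun (congrFun (hM k) l) j
  rw [h, Submodule.mem_bot] at hv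
  exact congrFun hv i

/-- A right inverse of the controllability matrix, built column by column: every basis vector is a
finite combination of reachable states. -/
theorem Controllable.exists_sum_eq_one [Fintype ι] {X : StateSpace σ ι o} (h : X.Controllable) :
    ∃ (s : Finset ℕ) (Z : ℕ → Matrix ι σ ℂ), ∑ k ∈ s, X.A ^ k * X.B * Z k = 1 := by
  have hj : ∀ j : σ, ∃ (s : Finset ℕ) (u : ℕ → ι → ℂ), (∀ k ∉ s, u k = 0) ∧
      ∑ k ∈ s, (X.A ^ k * X.B) *ᵥ u k = Pi.single j 1 := by
    intro j
    have hmem : (Pi.single j 1 : σ → ℂ) ∈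
        ⨆ k : ℕ, LinearMap.range (X.A ^ k * X.B).mulVecLin := by
      rw [h]
      exact Submodule.mem_top
    obtain ⟨f, hf, hsum⟩ := (Submodule.mem_iSup_iff_exists_finsupp _ _).1 hmem
    choose u hu using hf
    -- Inputs are cut off outside the support, so that all columns can later be summed over one
    -- common set of exponents.
    refine ⟨f.support, fun k => if k ∈ f.support then u k else 0, fun k hk => if_neg hk, ?_⟩
    rw [← hsum, Finsupp.sum]
    refine Finset.sum_congr rfl fun k hk => ?_
    change (X.A ^ k * X.B) *ᵥ (if k ∈ f.support then u k else 0) = f k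
    rw [if_pos hk]
    exact hu k
  choose s u hu hsum using hj
  refine ⟨Finset.univ.biUnion s, fun k => of fun i j => u j k i, ?_⟩
  ext i j
  have h1 : ∑ k ∈ Finset.univ.biUnion s, (X.A ^ k * X.B) *ᵥ u j k = Pi.single j 1 := by
    rw [← hsum j]
    symm
    refine Finset.sum_subset (Finset.subset_biUnion_of_mem s (Finset.mem_univ j)) fun k _ hk => ?_
    rw [hu j k hk, mulVec_zero]
  have h2 := congrFun h1 i
  rw [Finset.sum_apply] at h2
  rw [Matrix.sum_apply, one_apply, ← Pi.single_apply, ← h2]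
  rfl

/-- A controllable realization maps to any observable realization of the same transfer matrix. -/
theorem exists_intertwine [Fintype ι] {X : StateSpace σ ι o} {Y : StateSpace τ ι o}
    (h : X.transfer = Y.transfer) (hX : X.Controllable) (hY : Y.Distinguishing) :
    ∃ T : Matrix τ σ ℂ, Y.A * T = T * X.A ∧ T * X.B = Y.B ∧ Y.C * T = X.C := by
  obtain ⟨s, Z, hZ⟩ := hX.exists_sum_eq_one
  have hM := markov_eq_of_transfer_eq h
  set T : Matrix τ σ ℂ := ∑ k ∈ s, Y.A ^ k * Y.B * Z k with hT
  -- `T` is the controllability matrix of `Y` times a right inverse of that of `X`. Equality of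
  -- Markov parameters shows that `T` respects outputs, and the remaining relations follow because
  -- outputs distinguish the states of `Y`.
  have hCT : ∀ j, Y.C * Y.A ^ j * T = X.C * X.A ^ j := by
    intro j
    calc Y.C * Y.A ^ j * T = ∑ k ∈ s, Y.C * Y.A ^ (j + k) * Y.B * Z k := by
          rw [hT, Matrix.mul_sum]
          exact Finset.sum_congr rfl fun k _ => by simp only [pow_add, Matrix.mul_assoc]
      _ = ∑ k ∈ s, X.C * X.A ^ (j + k) * X.B * Z k := by simp only [hM]
      _ = X.C * X.A ^ j * ∑ k ∈ s, X.A ^ k * X.B * Z k := by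
          rw [Matrix.mul_sum]
          exact Finset.sum_congr rfl fun k _ => by simp only [pow_add, Matrix.mul_assoc]
      _ = _ := by rw [hZ, Matrix.mul_one]
  have hTB : T * X.B = Y.B := by
    rw [← sub_eq_zero]
    refine hY _ _ fun j => ?_
    rw [Matrix.mul_sub, ← Matrix.mul_assoc, hCT, hM, sub_self]
  have hTA : Y.A * T = T * X.A := by
    rw [← sub_eq_zero]
    refine hY _ _ fun j => ?_
    rw [Matrix.mul_sub, ← Matrix.mul_assoc, ← Matrix.mul_assoc, hCT, Matrix.mul_assoc Y.C,
      ← pow_succ, hCT, Matrix.mul_assoc X.C, ← pow_succ, sub_self]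
  refine ⟨T, hTA, hTB, ?_⟩
  simpa using hCT 0

end StateSpace

/-- A matrix `T` with `conj T * T = 1` is of the form `conj R * R⁻¹`. -/
theorem exists_conjM_eq_mul {T : Matrix σ σ ℂ} (hT : conjM T * T = 1) :
    ∃ R : Matrix σ σ ℂ, R.det ≠ 0 ∧ conjM R = T * R := by
  have hfin : {z : ℂ | (conjM T).charpoly.IsRoot z}.Finite :=
    Polynomial.finite_setOfPred_isRoot (conjM T).charpoly_monic.ne_zero
  have hne : ∀ t : ℝ, (t : ℂ) - Complex.I ≠ 0 := by
    intro t h0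
    have := congrArg Complex.im h0
    simp at this
  have hinj : Function.Injective fun t : ℝ =>
      -((t : ℂ) + Complex.I) / ((t : ℂ) - Complex.I) := by
    intro t u h
    simp only at h
    rw [div_eq_div_iff (hne t) (hne u)] at h
    have h1 : (2 * Complex.I) * ((t : ℂ) - u) = 0 := by linear_combination h
    have h2 : (t : ℂ) - u = 0 := by simpa using h1
    exact_mod_cast sub_eq_zero.1 h2
  -- A matrix form of Hilbert 90: any `R = c I + (conj c) (conj T)` satisfies `conj R = T R`. It is
  -- invertible when `-c / conj c` is not an eigenvalue of `conj T`. For `c = t + i` this ratio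
  -- takes infinitely many values, of which only finitely many are excluded.
  obtain ⟨t, ht⟩ : ∃ t : ℝ, ¬ (conjM T).charpoly.IsRoot
      (-((t : ℂ) + Complex.I) / ((t : ℂ) - Complex.I)) := by
    by_contra hcon
    push Not at hcon
    exact (Set.infinite_range_of_injective hinj)
      (hfin.subset (Set.range_subset_iff.2 hcon))
  have hT' : T * conjM T = 1 := mul_eq_one_comm.1 hT
  refine ⟨((t : ℂ) + Complex.I) • 1 + ((t : ℂ) - Complex.I) • conjM T, ?_, ?_⟩
  · have e : ((t : ℂ) + Complex.I) • (1 : Matrix σ σ ℂ) + ((t : ℂ) - Complex.I) • conjM T =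
        (-((t : ℂ) - Complex.I)) • (scalar σ (-((t : ℂ) + Complex.I) / ((t : ℂ) - Complex.I))
          - conjM T) := by
      rw [scalar_apply, ← smul_one_eq_diagonal, smul_sub, smul_smul]
      rw [show -((t : ℂ) - Complex.I) * (-((t : ℂ) + Complex.I) / ((t : ℂ) - Complex.I)) =
        (t : ℂ) + Complex.I by field_simp [hne t]]
      rw [neg_smul, sub_neg_eq_add]
    rw [e, det_smul, ← eval_charpoly]
    exact mul_ne_zero (pow_ne_zero _ (neg_ne_zero.2 (hne t))) ht
  · rw [conjM_add, conjM_smul, conjM_smul, conjM_one, conjM_conjM, Matrix.mul_add,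
      Matrix.mul_smul, Matrix.mul_smul, hT', Matrix.mul_one]
    simp [add_comm, sub_eq_add_neg]

/-- A realization which is invariant under the conjugation of doubled-up signals, separating,
distinguishing and spectrally generic. -/
structure IsRealMinimal [Fintype κ] [DecidableEq κ] (X : StateSpace σ (κ ⊕ κ) (κ ⊕ κ)) : Prop where
  separating : X.Separating
  distinguishing : X.Distinguishing
  generic : IsSpectrallyGeneric X.A
  conj_A : conjM X.A = X.A
  conj_B : conjM X.B = X.B * swapM κ ℂ
  conj_C : conjM X.C = swapM κ ℂ * X.C

theorem exists_realMinimal [Fintype κ] [DecidableEq κ] {X : StateSpace σ (κ ⊕ κ) (κ ⊕ κ)}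
    (hmin : X.Minimal) (hgen : IsSpectrallyGeneric X.A) (hdbl : IsDoubledUp X.transfer) :
    ∃ Y : StateSpace σ (κ ⊕ κ) (κ ⊕ κ), Y.transfer = X.transfer ∧ IsRealMinimal Y := by
  have hXs := hmin.1.separating
  have hXd := hmin.2.distinguishing
  have hSS : swapM κ ℂ * swapM κ ℂ = 1 := swapM_mul_swapM
  -- By the doubled-up symmetry the conjugated realization, with swapped inputs and outputs, has the
  -- same transfer matrix. It is again distinguishing, so `X` is intertwined with it.
  have htr : X.transfer = StateSpace.transfer (⟨conjM X.A, conjM X.B * swapM κ ℂ,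
      swapM κ ℂ * conjM X.C, swapM κ ℂ * conjM X.D * swapM κ ℂ⟩ :
        StateSpace σ (κ ⊕ κ) (κ ⊕ κ)) := by
    rw [← hdbl.swap_conj, X.map_ratConj_transfer, StateSpace.transfer_eq, StateSpace.transfer_eq]
    simp only [constTM_mul, constTM_swapM, Matrix.mul_add, Matrix.add_mul, Matrix.mul_assoc]
  obtain ⟨T, hTA, hTB, hTC⟩ := StateSpace.exists_intertwine htr hmin.1 (by
    intro υ M hM
    have h1 : conjM M = 0 := by
      refine hXd _ _ fun k => ?_
      have h2 := congrArg conjM (congrArg (swapM κ ℂ * ·) (hM k))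
      simp only [← Matrix.mul_assoc, hSS, Matrix.one_mul, Matrix.mul_zero, conjM_zero] at h2
      have h3 : ∀ k, conjM (conjM X.A ^ k) = X.A ^ k := by
        intro k
        induction k with
        | zero => simp [conjM_one]
        | succ k ih => rw [pow_succ, conjM_mul, ih, conjM_conjM, pow_succ]
      rwa [conjM_mul, conjM_mul, conjM_conjM, h3] at h2
    rw [← conjM_conjM M, h1, conjM_zero])
  simp only at hTA hTB hTC
  have hTA' : X.A * conjM T = conjM T * conjM X.A := by
    rw [← conjM_mul, ← hTA, conjM_mul, conjM_conjM]
  -- Applying the intertwiner twice commutes with `A` and fixes `B`, so it is the identity on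
  -- reachable states.
  have hTT : conjM T * T = 1 := by
    rw [← sub_eq_zero]
    refine hXs _ _ fun k => ?_
    have h1 : X.A * (conjM T * T) = conjM T * T * X.A := by
      rw [← Matrix.mul_assoc, hTA', Matrix.mul_assoc, hTA, Matrix.mul_assoc]
    have h2 : conjM T * T * X.B = X.B := by
      rw [Matrix.mul_assoc, hTB, ← Matrix.mul_assoc, ← conjM_conjM (conjM T * conjM X.B),
        conjM_mul, conjM_conjM, conjM_conjM, hTB, conjM_mul, conjM_conjM, conjM_swapM,
        Matrix.mul_assoc, hSS, Matrix.mul_one]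
    rw [Matrix.sub_mul, ← pow_intertwine h1, Matrix.one_mul, Matrix.sub_mul, Matrix.mul_assoc, h2,
      sub_self]
  obtain ⟨R, hR, hcR⟩ := exists_conjM_eq_mul hTT
  have hRu : IsUnit R.det := hR.isUnit
  have hRR : R * R⁻¹ = 1 := mul_nonsing_inv _ hRu
  have hRR' : R⁻¹ * R = 1 := nonsing_inv_mul _ hRu
  have hcRinv : conjM R⁻¹ * (T * R) = 1 := by
    rw [← hcR, ← conjM_mul, hRR', conjM_one]
  have hcRinv' : conjM R⁻¹ * T = R⁻¹ := by
    have := congrArg (· * R⁻¹) hcRinv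
    simpa only [Matrix.mul_assoc, hRR, Matrix.mul_one, Matrix.one_mul] using this
  have hpow : ∀ k, (R⁻¹ * X.A * R) ^ k * R⁻¹ = R⁻¹ * X.A ^ k := by
    refine pow_intertwine ?_
    rw [Matrix.mul_assoc, hRR, Matrix.mul_one]
  have hpow' : ∀ k, X.A ^ k * R = R * (R⁻¹ * X.A * R) ^ k := by
    refine pow_intertwine ?_
    rw [← Matrix.mul_assoc, ← Matrix.mul_assoc, hRR, Matrix.one_mul]
  refine ⟨⟨R⁻¹ * X.A * R, R⁻¹ * X.B, X.C * R, X.D⟩, ?_, ?_, ?_, ?_, ?_, ?_, ?_⟩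
  · refine StateSpace.transfer_eq_of_intertwine R⁻¹ ?_ rfl ?_ rfl
    · simp only
      rw [Matrix.mul_assoc, hRR, Matrix.mul_one]
    · simp only
      rw [Matrix.mul_assoc, hRR, Matrix.mul_one]
  · intro υ M hM
    have : M * R⁻¹ = 0 := by
      refine hXs _ _ fun k => ?_
      have h1 := hM k
      simp only at h1
      rwa [Matrix.mul_assoc M, ← Matrix.mul_assoc _ R⁻¹, hpow, ← Matrix.mul_assoc,
        ← Matrix.mul_assoc] at h1
    rw [← Matrix.mul_one M, ← hRR', ← Matrix.mul_assoc, this, Matrix.zero_mul]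
  · intro υ M hM
    have : R * M = 0 := by
      refine hXd _ _ fun k => ?_
      have h1 := hM k
      simp only at h1
      rwa [Matrix.mul_assoc X.C, ← hpow', ← Matrix.mul_assoc, Matrix.mul_assoc] at h1
    rw [← Matrix.one_mul M, ← hRR', Matrix.mul_assoc, this, Matrix.mul_zero]
  · have hsp : spectrum ℂ (R⁻¹ * X.A * R) = spectrum ℂ X.A := by
      ext z
      rw [mem_spectrum_iff_isRoot_charpoly, mem_spectrum_iff_isRoot_charpoly]
      have : (R⁻¹ * X.A * R).charpoly = X.A.charpoly := by
        rw [charpoly_mul_comm, ← Matrix.mul_assoc, hRR, Matrix.one_mul]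
      rw [this]
    intro z hz w hw
    exact hgen z (hsp ▸ hz) w (hsp ▸ hw)
  · simp only
    rw [conjM_mul, conjM_mul, hcR, Matrix.mul_assoc, ← Matrix.mul_assoc (conjM X.A), hTA]
    simp only [← Matrix.mul_assoc, hcRinv']
  · simp only
    have h1 : R⁻¹ * X.B = conjM R⁻¹ * (T * X.B) := by rw [← Matrix.mul_assoc, hcRinv']
    rw [conjM_mul, h1, hTB, Matrix.mul_assoc, Matrix.mul_assoc, hSS, Matrix.mul_one]
  · simp only
    have h1 : conjM X.C * T = swapM κ ℂ * X.C := by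
      have := congrArg (swapM κ ℂ * ·) hTC
      simpa only [← Matrix.mul_assoc, hSS, Matrix.one_mul] using this
    rw [conjM_mul, hcR, ← Matrix.mul_assoc, h1, Matrix.mul_assoc]

end Minimal

/-! ### The Lyapunov equation of a `(J, J)`-unitary transfer matrix -/

section Lyapunov

variable {σ κ : Type} [Fintype σ] [DecidableEq σ]

theorem isUnit_aeval_of_spectrum {A : Matrix σ σ ℂ} {p : Polynomial ℂ} (hp : p.Monic)
    (h : ∀ z ∈ spectrum ℂ A, p.eval z ≠ 0) : IsUnit (Polynomial.aeval A p) := by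
  by_contra hn
  rw [(IsAlgClosed.splits p).eq_prod_roots_of_monic hp] at hn
  obtain ⟨z, hz, h0⟩ := spectrum.exists_mem_of_not_isUnit_aeval_prod hn
  exact h z hz h0

theorem mem_spectrum_neg_conjTranspose {A : Matrix σ σ ℂ} {z : ℂ}
    (h : z ∈ spectrum ℂ (-Aᴴ)) : -star z ∈ spectrum ℂ A := by
  have h1 : -z ∈ spectrum ℂ (star A) := by
    rw [← Set.neg_mem_neg, neg_neg, spectrum.neg_eq]
    exact h
  rw [spectrum.map_star, Set.mem_star] at h1
  simpa using h1

/-- The eigenvalues of `-A^*` are the numbers `-conj ν` for eigenvalues `ν` of `A`, and genericity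
says that none is an eigenvalue of `A`. The characteristic polynomial of `-A^*` thus annihilates
`-A^*` but is invertible at `A`. -/
theorem isUnit_aeval_of_generic {A : Matrix σ σ ℂ} (h : IsSpectrallyGeneric A) :
    IsUnit (Polynomial.aeval A (-Aᴴ).charpoly) := by
  refine isUnit_aeval_of_spectrum (charpoly_monic _) fun z hz h0 => ?_
  have h1 := mem_spectrum_neg_conjTranspose (mem_spectrum_iff_isRoot_charpoly.2 h0)
  exact h z hz _ h1 (by simp)

theorem aeval_intertwine {P A X : Matrix σ σ ℂ} (h : P * X = X * A) (p : Polynomial ℂ) :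
    Polynomial.aeval P p * X = X * Polynomial.aeval A p := by
  induction p using Polynomial.induction_on' with
  | add p q hp hq => rw [map_add, map_add, Matrix.add_mul, Matrix.mul_add, hp, hq]
  | monomial k c =>
    rw [Polynomial.aeval_monomial, Polynomial.aeval_monomial, ← Algebra.smul_def,
      ← Algebra.smul_def, Matrix.smul_mul, Matrix.mul_smul, pow_intertwine h]

/-- The equation says that `X` intertwines `A` with `-A^*`. Applying the characteristic polynomial
of `-A^*` leaves `X` times an invertible matrix equal to zero. -/
theorem lyapunov_unique {A X : Matrix σ σ ℂ} (h : IsSpectrallyGeneric A)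
    (hX : Aᴴ * X + X * A = 0) : X = 0 := by
  have h1 := aeval_intertwine (P := -Aᴴ) (X := X) (A := A)
    (by rw [Matrix.neg_mul, neg_eq_iff_add_eq_zero, hX]) (-Aᴴ).charpoly
  rw [aeval_self_charpoly, Matrix.zero_mul] at h1
  exact (isUnit_aeval_of_generic h).mul_left_eq_zero.1 h1.symm

theorem lyapunov_exists {A : Matrix σ σ ℂ} (h : IsSpectrallyGeneric A) (Y : Matrix σ σ ℂ) :
    ∃ X, Aᴴ * X + X * A = Y := by
  let f : Matrix σ σ ℂ →ₗ[ℂ] Matrix σ σ ℂ :=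
    LinearMap.mulLeft ℂ Aᴴ + LinearMap.mulRight ℂ A
  have hinj : Function.Injective f := by
    rw [← LinearMap.ker_eq_bot, LinearMap.ker_eq_bot']
    intro X hX
    exact lyapunov_unique h hX
  exact (LinearMap.injective_iff_surjective.1 hinj) Y

variable [Fintype κ] [DecidableEq κ]

/-- If the transfer matrix is `(J, J)`-unitary, then the solution of the Lyapunov equation relates
the input and the output matrices. -/
theorem lyapunov_lossless {X : StateSpace σ (κ ⊕ κ) (κ ⊕ κ)} (hsep : X.Separating)
    (hgen : IsSpectrallyGeneric X.A)
    (hJ : sysConj X.transfer * sigJ κ (RatFunc ℂ) * X.transfer = sigJ κ (RatFunc ℂ))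
    {P : Matrix σ σ ℂ} (hPh : Pᴴ = P)
    (hP : X.Aᴴ * P + P * X.A = -(X.Cᴴ * sigJ κ ℂ * X.C)) :
    X.Dᴴ * sigJ κ ℂ * X.D = sigJ κ ℂ ∧ X.Dᴴ * sigJ κ ℂ * X.C + X.Bᴴ * P = 0 := by
  obtain ⟨A, B, C, D⟩ := X
  simp only at *
  set J := sigJ κ ℂ with hJdef
  set W := Dᴴ * J * C + Bᴴ * P with hW
  have hWh : Wᴴ = Cᴴ * J * D + P * B := by
    rw [hW, conjTranspose_add, conjTranspose_mul, conjTranspose_mul, conjTranspose_mul, hPh,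
      conjTranspose_conjTranspose, conjTranspose_conjTranspose, hJdef, conjTranspose_sigJ,
      ← Matrix.mul_assoc]
  -- A partial fraction decomposition: the Lyapunov equation reads `(s I + A^*) P - P (s I - A) =
  -- -C^* J C`, which splits the product of the two resolvents.
  have hres : resolventTM (-Aᴴ) * (constTM Cᴴ * constTM J * constTM C) * resolventTM A =
      resolventTM (-Aᴴ) * constTM P - constTM P * resolventTM A := by
    have h1 : charTM (-Aᴴ) * constTM P - constTM P * charTM A =
        -(constTM Cᴴ * constTM J * constTM C) := by
      have h2 := congrArg constTM hP
      simp only [constTM_add, constTM_mul, constTM_neg] at h2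
      rw [← h2, charTM, charTM, constTM_neg, Matrix.sub_mul, Matrix.mul_sub, Matrix.smul_mul,
        Matrix.mul_smul, Matrix.one_mul, Matrix.mul_one, Matrix.neg_mul]
      abel
    rw [← neg_inj, ← Matrix.neg_mul, ← Matrix.mul_neg, ← h1, Matrix.mul_sub, Matrix.sub_mul,
      ← Matrix.mul_assoc, resolventTM_mul_charTM, Matrix.one_mul, ← Matrix.mul_assoc,
      Matrix.mul_assoc _ (charTM A), charTM_mul_resolventTM, Matrix.mul_one, neg_sub]
  -- Losslessness after the splitting: the terms with state matrix `A` are separated from those with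
  -- `-A^*`.
  have htr : StateSpace.transfer (⟨A, B, W, Dᴴ * J * D⟩ : StateSpace σ (κ ⊕ κ) (κ ⊕ κ)) =
      StateSpace.transfer ⟨-Aᴴ, Wᴴ, Bᴴ, J⟩ := by
    rw [StateSpace.sysConj_transfer, StateSpace.transfer_eq, ← constTM_sigJ] at hJ
    simp only at hJ
    rw [StateSpace.transfer_eq, StateSpace.transfer_eq, hWh, hW]
    simp only [constTM_add, constTM_mul]
    rw [← hJdef] at hJ
    rw [← sub_eq_zero] at hJ ⊢
    have h3 := congrArg (fun Z => constTM Bᴴ * Z * constTM B) hres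
    simp only [Matrix.mul_add, Matrix.add_mul, Matrix.mul_sub, Matrix.sub_mul, Matrix.neg_mul,
      Matrix.mul_assoc] at hJ h3 ⊢
    rw [h3] at hJ
    rw [← hJ]
    abel
  have hD := StateSpace.D_eq_of_transfer_eq htr
  have hM := StateSpace.markov_eq_of_transfer_eq htr
  simp only at hD hM
  refine ⟨hD, ?_⟩
  clear_value W
  have hpoly : ∀ p : Polynomial ℂ, W * Polynomial.aeval A p * B =
      Bᴴ * Polynomial.aeval (-Aᴴ) p * Wᴴ := by
    intro p
    induction p using Polynomial.induction_on' with
    | add p q hp hq =>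
      rw [map_add, map_add, Matrix.mul_add, Matrix.mul_add, Matrix.add_mul, Matrix.add_mul, hp, hq]
    | monomial k c =>
      rw [Polynomial.aeval_monomial, Polynomial.aeval_monomial, ← Algebra.smul_def,
        ← Algebra.smul_def, Matrix.mul_smul, Matrix.mul_smul, Matrix.smul_mul, Matrix.smul_mul, hM]
  -- By Cayley–Hamilton the right-hand side of `hpoly` vanishes for every multiple of the
  -- characteristic polynomial of `-A^*`. The multiples by powers of `X` cover all reachable states.
  have h0 : W * Polynomial.aeval A (-Aᴴ).charpoly = 0 := by
    refine hsep _ _ fun k => ?_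
    have := hpoly ((-Aᴴ).charpoly * Polynomial.X ^ k)
    rwa [map_mul, map_mul, aeval_self_charpoly, Matrix.zero_mul, Matrix.mul_zero, Matrix.zero_mul,
      map_pow, Polynomial.aeval_X, ← Matrix.mul_assoc] at this
  obtain ⟨u, hu⟩ := isUnit_aeval_of_generic hgen
  rw [← hu] at h0
  have := congrArg (· * (↑u⁻¹ : Matrix σ σ ℂ)) h0
  simpa [Matrix.mul_assoc] using this

/-- The kernel of `P` lies in that of `C`, since `D^* J` is invertible. The Lyapunov equation then
makes it `A`-invariant, so its states are unobservable. -/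
theorem isUnit_det_of_lossless {X : StateSpace σ (κ ⊕ κ) (κ ⊕ κ)} (hdis : X.Distinguishing)
    {P : Matrix σ σ ℂ} (hP : X.Aᴴ * P + P * X.A = -(X.Cᴴ * sigJ κ ℂ * X.C))
    (hD : X.Dᴴ * sigJ κ ℂ * X.D = sigJ κ ℂ)
    (hW : X.Dᴴ * sigJ κ ℂ * X.C + X.Bᴴ * P = 0) : IsUnit P.det := by
  rw [isUnit_iff_ne_zero]
  intro h0
  obtain ⟨v, hv, hPv⟩ := exists_mulVec_eq_zero_iff.2 h0
  set M : Matrix σ Unit ℂ := replicateCol Unit v with hM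
  have hPM : P * M = 0 := by
    ext i j
    exact congrFun hPv i
  have hinv : (X.D * sigJ κ ℂ) * (X.Dᴴ * sigJ κ ℂ) = 1 := by
    refine mul_eq_one_comm.1 ?_
    rw [← Matrix.mul_assoc, hD, sigJ_mul_sigJ]
  have hC : ∀ {Z : Matrix σ Unit ℂ}, P * Z = 0 → X.C * Z = 0 := by
    intro Z hZ
    have h1 := congrArg (· * Z) hW
    simp only [Matrix.add_mul, Matrix.zero_mul, Matrix.mul_assoc X.Bᴴ, hZ, Matrix.mul_zero,
      add_zero] at h1
    have h2 := congrArg ((X.D * sigJ κ ℂ) * ·) h1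
    simpa only [← Matrix.mul_assoc, hinv, Matrix.mul_zero, Matrix.mul_assoc (X.D * sigJ κ ℂ) X.Dᴴ,
      Matrix.one_mul] using h2
  have hk : ∀ k : ℕ, P * (X.A ^ k * M) = 0 := by
    intro k
    induction k with
    | zero => simpa using hPM
    | succ k ih =>
      have h1 := congrArg (· * (X.A ^ k * M)) hP
      simp only [Matrix.add_mul, Matrix.neg_mul, Matrix.mul_assoc X.Aᴴ, ih, Matrix.mul_zero,
        zero_add, Matrix.mul_assoc _ X.C, hC ih, neg_zero] at h1
      rwa [pow_succ', Matrix.mul_assoc X.A, ← Matrix.mul_assoc P]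
  have hM0 : M = 0 := hdis _ _ fun k => by rw [Matrix.mul_assoc]; exact hC (hk k)
  exact hv (funext fun i => congrFun (congrFun hM0 i) ())

end Lyapunov

/-! ### Physical realizability -/

section Realizability

theorem IsRealMinimal.isPhysicallyRealizable {k : ℕ} {κ : Type} [Fintype κ] [DecidableEq κ]
    {X : StateSpace (Fin k) (κ ⊕ κ) (κ ⊕ κ)} (h : IsRealMinimal X)
    (hJ : sysConj X.transfer * sigJ κ (RatFunc ℂ) * X.transfer = sigJ κ (RatFunc ℂ))
    (hD : X.D ∈ unitaryDoubled κ) : IsPhysicallyRealizable X.transfer := by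
  obtain ⟨P, hP⟩ := lyapunov_exists h.generic (-(X.Cᴴ * sigJ κ ℂ * X.C))
  have hPh : Pᴴ = P := by
    rw [← sub_eq_zero]
    refine lyapunov_unique h.generic ?_
    have h1 := congrArg conjTranspose hP
    simp only [conjTranspose_add, conjTranspose_mul, conjTranspose_neg, conjTranspose_conjTranspose,
      conjTranspose_sigJ] at h1
    rw [← Matrix.mul_assoc X.Cᴴ] at h1
    rw [Matrix.mul_sub, Matrix.sub_mul]
    calc X.Aᴴ * Pᴴ - X.Aᴴ * P + (Pᴴ * X.A - P * X.A)
        = (Pᴴ * X.A + X.Aᴴ * Pᴴ) - (X.Aᴴ * P + P * X.A) := by abel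
      _ = 0 := by rw [h1, hP, sub_self]
  -- Conjugating `C` exchanges its halves, and the exchange reverses the sign of `J`. As `A` is
  -- real, `-conj P` then solves the same Lyapunov equation as `P`.
  have hconjCJC : conjM (X.Cᴴ * sigJ κ ℂ * X.C) = -(X.Cᴴ * sigJ κ ℂ * X.C) := by
    rw [conjM_mul, conjM_mul, conjM_conjTranspose, h.conj_C, conjM_sigJ, conjTranspose_mul,
      conjTranspose_swapM]
    calc X.Cᴴ * swapM κ ℂ * sigJ κ ℂ * (swapM κ ℂ * X.C)
        = X.Cᴴ * (swapM κ ℂ * sigJ κ ℂ * swapM κ ℂ) * X.C := by simp only [Matrix.mul_assoc]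
      _ = _ := by rw [swapM_mul_sigJ_mul_swapM, Matrix.mul_neg, Matrix.neg_mul]
  have hPc : conjM P = -P := by
    rw [← sub_eq_zero, sub_neg_eq_add]
    refine lyapunov_unique h.generic ?_
    have h1 := congrArg conjM hP
    rw [conjM_add, conjM_mul, conjM_mul, conjM_conjTranspose, h.conj_A, conjM_neg, hconjCJC] at h1
    rw [Matrix.mul_add, Matrix.add_mul]
    calc X.Aᴴ * conjM P + X.Aᴴ * P + (conjM P * X.A + P * X.A)
        = (X.Aᴴ * conjM P + conjM P * X.A) + (X.Aᴴ * P + P * X.A) := by abel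
      _ = 0 := by rw [h1, hP]; abel
  obtain ⟨hDJ, hW⟩ := lyapunov_lossless h.separating h.generic hJ hPh hP
  have hPu := isUnit_det_of_lossless h.distinguishing hP hDJ hW
  set Θ := P⁻¹ with hΘ
  have hPΘ : P * Θ = 1 := mul_nonsing_inv _ hPu
  have hΘP : Θ * P = 1 := nonsing_inv_mul _ hPu
  have hΘh : Θᴴ = Θ := by rw [hΘ, conjTranspose_nonsing_inv, hPh]
  have hΘc : conjM Θ = -Θ := by
    have h1 : -conjM Θ * P = 1 := by
      have := congrArg conjM hΘP
      rwa [conjM_mul, hPc, conjM_one, Matrix.mul_neg, ← Matrix.neg_mul] at this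
    have h2 := congrArg (· * Θ) h1
    simp only [Matrix.mul_assoc, hPΘ, Matrix.mul_one, Matrix.one_mul] at h2
    exact neg_eq_iff_eq_neg.1 h2
  have hB : X.B = -(Θ * X.Cᴴ * sigJ κ ℂ * X.D) := by
    have h1 := congrArg conjTranspose hW
    simp only [conjTranspose_add, conjTranspose_mul, conjTranspose_conjTranspose,
      conjTranspose_sigJ, hPh, conjTranspose_zero] at h1
    have h2 := congrArg (Θ * ·) (eq_neg_of_add_eq_zero_right h1)
    simp only [← Matrix.mul_assoc, hΘP, Matrix.one_mul, Matrix.mul_neg] at h2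
    exact h2
  -- Obtained by solving `A = -i Θ H - ½ Θ C^* J C` for `H`. The Lyapunov equation is exactly what
  -- makes it Hermitian.
  set H := Complex.I • (P * X.A) + (Complex.I / 2) • (X.Cᴴ * sigJ κ ℂ * X.C) with hH
  have hHh : Hᴴ = H := by
    have h1 : X.Aᴴ * P = -(X.Cᴴ * sigJ κ ℂ * X.C) - P * X.A := eq_sub_of_add_eq hP
    rw [hH, conjTranspose_add, conjTranspose_smul, conjTranspose_smul, conjTranspose_mul,
      conjTranspose_mul, conjTranspose_mul, conjTranspose_conjTranspose, conjTranspose_sigJ, hPh, h1,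
      ← Matrix.mul_assoc]
    simp only [star_div₀, RCLike.star_def, Complex.conj_I, Complex.conj_ofNat]
    module
  have hHc : conjM H = H := by
    rw [hH, conjM_add, conjM_smul, conjM_smul, conjM_mul, hPc, h.conj_A, hconjCJC]
    simp only [map_div₀, Complex.conj_I, Complex.conj_ofNat]
    rw [Matrix.neg_mul]
    module
  have hA : X.A = -(Complex.I • (Θ * H)) - (1 / 2 : ℂ) • (Θ * (X.Cᴴ * sigJ κ ℂ * X.C)) := by
    rw [hH, Matrix.mul_add, Matrix.mul_smul, Matrix.mul_smul, ← Matrix.mul_assoc Θ P, hΘP,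
      Matrix.one_mul, smul_add, smul_smul, smul_smul, ← mul_div_assoc, Complex.I_mul_I]
    module
  obtain ⟨S, hS, hDS⟩ := hD
  obtain ⟨C₁, hC⟩ : ∃ C₁ : Matrix κ (Fin k) ℂ, X.C = fromRows C₁ (conjM C₁) := by
    refine ⟨X.C.toRows₁, ?_⟩
    have h1 := h.conj_C
    ext (i | i) j
    · rfl
    · have h2 := congrFun (congrFun h1 (Sum.inl i)) j
      have h3 : (swapM κ ℂ * X.C) (Sum.inl i) j = X.C (Sum.inr i) j := by
        simp [Matrix.mul_apply, swapM, Fintype.sum_sum_type, one_apply]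
      rw [h3] at h2
      exact h2.symm
  -- The real state `x` is placed in the doubled vector as `(x, x)`. Since `Eᵀ E = 2`, the weights
  -- `1/4` for `H` and `1/2` for `C` below restore the original system on the range of `E`.
  set E : Matrix (Fin k ⊕ Fin k) (Fin k) ℂ := fromRows 1 1 with hE
  have hblk : ∀ M : Matrix (Fin k) (Fin k) ℂ, E * M * Eᵀ = fromBlocks M M M M := by
    intro M
    rw [hE, transpose_fromRows, transpose_one, fromRows_mul, Matrix.one_mul, fromRows_mul_fromCols,
      Matrix.mul_one]
  have hEE : Eᵀ * E = (2 : ℂ) • 1 := by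
    rw [hE, transpose_fromRows, transpose_one, fromCols_mul_fromRows, Matrix.one_mul, two_smul]
  have hEt : Eᵀᴴ = E := by
    rw [hE, transpose_fromRows, transpose_one, conjTranspose_fromCols_eq_fromRows_conjTranspose,
      conjTranspose_one]
  -- Chosen so that `F₁² - F₂² = Θ`, both factors are Hermitian, and `conj F₁ = F₂`. All four blocks
  -- of `F J F^*` then equal `Θ`. This `F` need not be invertible, and the oscillator does not
  -- require it to be.
  set F₁ : Matrix (Fin k) (Fin k) ℂ := 1 + (1 / 4 : ℂ) • Θ with hF₁
  set F₂ : Matrix (Fin k) (Fin k) ℂ := 1 - (1 / 4 : ℂ) • Θ with hF₂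
  have hc4 : starRingEnd ℂ (1 / 4) = 1 / 4 := by
    rw [map_div₀, map_one, Complex.conj_ofNat]
  have hF₁c : F₁.map star = F₂ := by
    change conjM F₁ = F₂
    rw [hF₁, conjM_add, conjM_one, conjM_smul, hΘc, hc4, smul_neg, ← sub_eq_add_neg]
  have hF₂c : F₂.map star = F₁ := by
    rw [← hF₁c]
    exact conjM_conjM F₁
  have hF₁h : F₁ᴴ = F₁ := by
    rw [hF₁, conjTranspose_add, conjTranspose_one, conjTranspose_smul, hΘh]
    simp
  have hF₂h : F₂ᴴ = F₂ := by
    rw [hF₂, conjTranspose_sub, conjTranspose_one, conjTranspose_smul, hΘh]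
    simp
  have hF : F₁ * F₁ - F₂ * F₂ = Θ := by
    simp only [hF₁, hF₂, Matrix.mul_add, Matrix.add_mul, Matrix.mul_sub, Matrix.sub_mul,
      Matrix.smul_mul, Matrix.mul_smul, Matrix.mul_one, Matrix.one_mul]
    module
  have hccr : doubled F₁ F₂ * sigJ (Fin k) ℂ * (doubled F₁ F₂)ᴴ = E * Θ * Eᵀ := by
    rw [hblk, doubled, hF₁c, hF₂c, sigJ, fromBlocks_conjTranspose, fromBlocks_multiply,
      fromBlocks_multiply, hF₁h, hF₂h, ← hF]
    simp [sub_eq_add_neg]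
  have hHd : doubled ((1 / 4 : ℂ) • H) ((1 / 4 : ℂ) • H) = (1 / 4 : ℂ) • (E * H * Eᵀ) := by
    have h1 : ((1 / 4 : ℂ) • H).map star = (1 / 4 : ℂ) • H := by
      change conjM _ = _
      rw [conjM_smul, hHc, hc4]
    rw [hblk, doubled, h1, fromBlocks_smul]
  have hL : doubled ((1 / 2 : ℂ) • C₁) ((1 / 2 : ℂ) • C₁) = (1 / 2 : ℂ) • (X.C * Eᵀ) := by
    have h1 : ((1 / 2 : ℂ) • C₁).map star = (1 / 2 : ℂ) • conjM C₁ := by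
      change conjM _ = _
      rw [conjM_smul, map_div₀, map_one, Complex.conj_ofNat]
    rw [hC, hE, transpose_fromRows, transpose_one, fromRows_mul_fromCols, Matrix.mul_one,
      Matrix.mul_one, fromBlocks_smul, doubled, h1]
  have hLh : ((1 / 2 : ℂ) • (X.C * Eᵀ))ᴴ = (1 / 2 : ℂ) • (E * X.Cᴴ) := by
    rw [conjTranspose_smul, conjTranspose_mul, hEt]
    simp
  let G : OpenOscillator (Fin k) κ :=
    { F₁ := F₁
      F₂ := F₂
      H₁ := (1 / 4 : ℂ) • H
      H₂ := (1 / 4 : ℂ) • H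
      hermitian := by
        rw [hHd, hblk, IsHermitian, conjTranspose_smul, fromBlocks_conjTranspose, hHh]
        simp
      L₁ := (1 / 2 : ℂ) • C₁
      L₂ := (1 / 2 : ℂ) • C₁
      S := S
      unitary := hS }
  have hEEx : ∀ {υ : Type} (Z : Matrix (Fin k) υ ℂ), Eᵀ * (E * Z) = (2 : ℂ) • Z := by
    intro υ Z
    rw [← Matrix.mul_assoc, hEE, Matrix.smul_mul, Matrix.one_mul]
  refine ⟨k, G, StateSpace.transfer_eq_of_intertwine E ?_ ?_ ?_ ?_⟩
  · change (-(Complex.I • (doubled F₁ F₂ * sigJ (Fin k) ℂ * (doubled F₁ F₂)ᴴ *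
      doubled ((1 / 4 : ℂ) • H) ((1 / 4 : ℂ) • H))) - (1 / 2 : ℂ) • (doubled F₁ F₂ *
        sigJ (Fin k) ℂ * (doubled F₁ F₂)ᴴ * (doubled ((1 / 2 : ℂ) • C₁) ((1 / 2 : ℂ) • C₁))ᴴ *
        sigJ κ ℂ * doubled ((1 / 2 : ℂ) • C₁) ((1 / 2 : ℂ) • C₁))) * E = E * X.A
    rw [hccr, hHd, hL, hLh]
    conv_rhs => rw [hA]
    simp only [Matrix.sub_mul, Matrix.neg_mul, Matrix.mul_sub, Matrix.mul_neg, Matrix.smul_mul,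
      Matrix.mul_smul, Matrix.mul_assoc, hEEx, hEE, Matrix.mul_one]
    module
  · change -(doubled F₁ F₂ * sigJ (Fin k) ℂ * (doubled F₁ F₂)ᴴ *
      (doubled ((1 / 2 : ℂ) • C₁) ((1 / 2 : ℂ) • C₁))ᴴ * sigJ κ ℂ * doubled S 0) = E * X.B
    rw [hccr, hL, hLh, hB, ← hDS]
    simp only [Matrix.mul_neg, Matrix.smul_mul, Matrix.mul_smul, Matrix.mul_assoc, hEEx]
    module
  · change doubled ((1 / 2 : ℂ) • C₁) ((1 / 2 : ℂ) • C₁) * E = X.C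
    rw [hL]
    simp only [Matrix.smul_mul, Matrix.mul_assoc, hEE, Matrix.mul_smul, Matrix.mul_one]
    module
  · exact hDS.symm

/-- A spectrally generic doubled-up `(J, J)`-unitary transfer matrix whose value at infinity is in
`𝔻` is physically realizable. -/
theorem isPhysicallyRealizable_of_lossless {κ : Type} [Fintype κ] [DecidableEq κ]
    {K : TransferMatrix (κ ⊕ κ) (κ ⊕ κ)}
    (hJ : sysConj K * sigJ κ (RatFunc ℂ) * K = sigJ κ (RatFunc ℂ)) (hdbl : IsDoubledUp K)
    (hgen : IsSpectrallyGenericTM K) {D : Matrix (κ ⊕ κ) (κ ⊕ κ) ℂ} (hD : D ∈ unitaryDoubled κ)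
    (hKD : HasFeedthrough K D) : IsPhysicallyRealizable K := by
  obtain ⟨k, X, rfl, hmin, hA⟩ := hgen
  obtain ⟨Y, hY, hreal⟩ := exists_realMinimal hmin hA hdbl
  rw [← hY] at hJ hKD ⊢
  refine hreal.isPhysicallyRealizable hJ ?_
  rwa [← Y.hasFeedthrough_transfer.2, hKD.2]

theorem sysConj_sysConj {o ι : Type} (T : TransferMatrix o ι) : sysConj (sysConj T) = T := by
  have hp : ∀ p : Polynomial ℂ, polyConj (polyNeg (polyConj (polyNeg p))) = p := by
    intro p
    have h1 : polyNeg (polyConj (polyNeg p)) = polyConj p := by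
      simp [polyNeg, polyConj, Polynomial.map_comp, Polynomial.comp_assoc]
    rw [h1]
    ext n
    simp [polyConj]
  ext i j
  change ratConj (ratNeg (ratConj (ratNeg (T i j)))) = T i j
  rw [← RatFunc.num_div_denom (T i j)]
  simp only [map_div₀, ratNeg_algebraMap, ratConj_algebraMap, hp]

/-- The quadratic constraint on the Youla-Kucera parameter makes the controller
`(J, J)`-unitary. -/
theorem controller_lossless {κ : Type} [Fintype κ] [DecidableEq κ]
    {N M U V Q : TransferMatrix (κ ⊕ κ) (κ ⊕ κ)} (hQ : Q ∈ classQ N M U V)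
    (hV : (V + N * Q).det ≠ 0) :
    sysConj (youla N M U V Q) * sigJ κ (RatFunc ℂ) * youla N M U V Q = sigJ κ (RatFunc ℂ) := by
  have h := hQ.2.2
  set J := sigJ κ (RatFunc ℂ) with hJ
  have hJJ : sysConj J = J := by
    rw [hJ, ← constTM_sigJ, sysConj_constTM, conjTranspose_sigJ]
  have hsub : ∀ S T : TransferMatrix (κ ⊕ κ) (κ ⊕ κ),
      sysConj (S - T) = sysConj S - sysConj T := by
    intro S T
    rw [eq_sub_iff_add_eq, ← sysConj_add, sub_add_cancel]
  -- The constraint defining the class is this identity expanded in powers of `Q`, with `Φ`, `Λ` and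
  -- `Π` as coefficients.
  have key : sysConj (U + M * Q) * J * (U + M * Q) = sysConj (V + N * Q) * J * (V + N * Q) := by
    rw [← sub_eq_zero, ← h]
    simp only [hsub, sysConj_add, sysConj_mul, sysConj_sysConj, hJJ, Matrix.mul_add,
      Matrix.add_mul, Matrix.mul_sub, Matrix.sub_mul, Matrix.mul_assoc]
    abel
  have hVV : (V + N * Q) * (V + N * Q)⁻¹ = 1 := mul_nonsing_inv _ hV.isUnit
  calc sysConj (youla N M U V Q) * J * youla N M U V Q
      = sysConj (V + N * Q)⁻¹ * (sysConj (U + M * Q) * J * (U + M * Q)) * (V + N * Q)⁻¹ := by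
        rw [youla, sysConj_mul]
        simp only [Matrix.mul_assoc]
    _ = sysConj ((V + N * Q) * (V + N * Q)⁻¹) * J * ((V + N * Q) * (V + N * Q)⁻¹) := by
        rw [key, sysConj_mul]
        simp only [Matrix.mul_assoc]
    _ = J := by
        rw [hVV, ← constTM_one, sysConj_constTM, conjTranspose_one, constTM_one, Matrix.one_mul,
          Matrix.mul_one]

end Realizability

end

/-! ### The main theorem -/

theorem theorem2 (n r μ : ℕ) (G : OpenOscillator (Fin n) (Fin r ⊕ Fin μ))
    (N M N' M' U V U' V' : TransferMatrix (Fin μ ⊕ Fin μ) (Fin μ ⊕ Fin μ))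
    (hfact : IsDoublyCoprime G.modifiedPlant.toBlocks₂₂ N M N' M' U V U' V')
    (Q : TransferMatrix (Fin μ ⊕ Fin μ) (Fin μ ⊕ Fin μ)) (hQ : Q ∈ classQhat N M U V)
    (K : TransferMatrix (Fin μ ⊕ Fin μ) (Fin μ ⊕ Fin μ)) (hK : K = youla N M U V Q) :
    -- the factorizations of the controller are well-defined and agree
    ((V + N * Q).det ≠ 0 ∧ (V' + Q * N').det ≠ 0 ∧
      K = (V' + Q * N')⁻¹ * (U' + Q * M') ∧
      (V.det ≠ 0 → V'.det ≠ 0 ∧ (1 - -(V⁻¹ * N) * Q).det ≠ 0 ∧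
        K = lowerLFT (U * V⁻¹) V'⁻¹ V⁻¹ (-(V⁻¹ * N)) Q)) ∧
    -- the controller is stabilizing: for the loop with the (2,2) block of the modified plant, and
    -- for the loop with the plant itself if the latter is stabilizable and detectable through
    -- the controller's fields
    StabilizesTransfer G.modifiedPlant.toBlocks₂₂ K ∧
    (G.stateSpace22.Stabilizable → G.stateSpace22.Detectable →
      StabilizesSystem G.stateSpace22 K) ∧
    -- the controller is physically realizable
    IsPhysicallyRealizable K := by
  obtain ⟨hQc, hdbl, hgen, D, hD, hKD⟩ := hQ
  have hshift := hfact.shift hQc.1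
  have hVp : EntriesIn properSubring (V + N * Q) :=
    EntriesIn.mono stableSubring_le_properSubring hshift.V_stable
  have hVQ : (V + N * Q).det ≠ 0 := by
    intro h0
    apply hQc.2.1
    rw [← valInfty_det hVp, h0, valInfty_zero]
  obtain ⟨hV'Q, hleft⟩ := hshift.left_coprime_controller hVQ
  obtain ⟨hloop, hloopS⟩ := hshift.loop_stable hVQ
  change K = (U + M * Q) * (V + N * Q)⁻¹ at hK
  rw [← hK] at hleft hloop hloopS
  refine ⟨⟨hVQ, hV'Q, hleft, fun hV => ?_⟩, ⟨hloop, hloopS, ?_⟩, ?_, ?_⟩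
  · obtain ⟨h1, h2⟩ := hfact.controller_eq_lowerLFT hV hVQ
    exact ⟨(hfact.left_coprime_controller hV).1, h1, hK.trans h2⟩
  · rintro k X hX hXs hXd l Y hY hYs hYd
    rw [← hX, ← hY] at hloop hloopS
    exact internallyStable_of_loop_stable hXs hXd hYs hYd hloop hloopS
  -- The induced realization is indexed by `Fin n ⊕ Fin n`, so it is not literally an instance of
  -- the previous case. The loop lemma applies to any finite state index.
  · rintro hs hd l Y hY hYs hYd
    rw [← G.stateSpace22_transfer, ← hY] at hloop hloopS
    exact internallyStable_of_loop_stable hs hd hYs hYd hloop hloopS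
  · rw [hK]
    exact isPhysicallyRealizable_of_lossless (controller_lossless hQc hVQ) hdbl hgen hD hKD
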